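/- Let $p$ be a prime and let $G$ be a finitely generated pro-$p$ group, given by a minimal presentation $$1\longrightarrow R\longrightarrow F\stackrel{\varphi}{\longrightarrow}G\longrightarrow 1 :$$ here $F$ is the free pro-$p$ group on $d$ generators, where $d=\dim_{\mathbb F_p}\bigl(\mathbb F_p\otimes G/[G,G]\bigr)$ is the $p$-rank of $G$, $\varphi$ is a continuous epimorphism, and $R=\ker\varphi$ is generated, as a closed normal subgroup of $F$, by a set of relators $\mathcal S\subset R$. (If $\mathcal S$ is finite, $G$ is finitely presented; infinite $\mathcal S$ is allowed.) For $x\in F$ let $\omega_F(x)=\max\{n : x-1\in I^n\}$ (with $\omega_F(1)=\infty$) be the Zassenhaus depth of $x$, where $I$ is the augmentation ideal of the completed group algebra $\mathbb F_p[[F]]$. Suppose that $r_k=\#\{\rho\in\mathcal S : \omega_F(\rho)=k\}$ is finite for every $k$, and let $P_{\mathcal P}(t)=1-dt+\sum_{k\ge 2}r_kt^k$ be the Golod–Shafarevich series of the presentation. Suppose that for some $t_0\in\,]0,1[$ the series converges at $t_0$ and $P_{\mathcal P}(t_0)<0$. For $T\subset F$ write $\langle T\rangle^{N}$ for the closed normal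 subgroup of $F$ generated by $T$. Then all sufficiently large integers $k\ge 2$ and $k'\ge 2$ satisfy $$P_{\mathcal P}(t_0)+t_0^k<0 \qquad\text{and}\qquad P_{\mathcal P}(t_0)+\frac{t_0^{k'}}{1-t_0}<0,$$ respectively, and: (i) for every integer $k\ge 2$ satisfying the first inequality and every $f\in F$ with $\omega_F(f)\ge k$, the map $\varphi$ induces an isomorphism of topological groups $F/\langle R,f\rangle^{N}\simeq G/\varphi(\langle f\rangle^{N})$, and this group is infinite; (ii) for every integer $k'\ge 2$ satisfying the second inequality and every sequence $(f_i)_{i\ge 0}$ in $F$ with $\omega_F(f_i)\ge k'+i$ for all $i$, the map $\varphi$ induces an isomorphism of topological groups $F/\langle R,f_i,\ i\ge 0\rangle^{N}\simeq G/\varphi(\langle f_i,\ i\ge 0\rangle^{N})$, and this group is infinite. -/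

import Mathlib

open scoped TensorProduct

noncomputable section

namespace GolodShafarevich

universe u v

/-- A topological group is pro-`p` if it is profinite (compact, Hausdorff, totally disconnected) and
all its open normal subgroups have `p`-power index. -/
structure IsProP (p : ℕ) (G : Type u) [Group G] [TopologicalSpace G] [IsTopologicalGroup G] :
    Prop where
  compact : CompactSpace G
  hausdorff : T2Space G
  totallyDisconnected : TotallyDisconnectedSpace G
  index_eq : ∀ U : OpenNormalSubgroup G, ∃ n : ℕ, U.toSubgroup.index = p ^ n

/-- `F` is the free pro-`p` group on the finite family `x`: it is a pro-`p` group, and every map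
from the index set to a pro-`p` group extends uniquely to a continuous homomorphism on `F`. -/
structure IsFreeProP (p : ℕ) {F : Type u} [Group F] [TopologicalSpace F] [IsTopologicalGroup F]
    {d : ℕ} (x : Fin d → F) : Prop where
  isProP : IsProP p F
  existsUnique_lift : ∀ (H : Type u) [Group H] [TopologicalSpace H] [IsTopologicalGroup H],
    IsProP p H → ∀ h : Fin d → H, ∃! ψ : F →ₜ* H, ∀ i, ψ (x i) = h i

/-- The `p`-rank of `G`: the dimension over `𝔽_p` of `𝔽_p ⊗ G / [G, G]`, where `[G, G]` is the
closed commutator subgroup. -/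
def pRank (p : ℕ) [Fact p.Prime] (G : Type u) [Group G] [TopologicalSpace G]
    [IsTopologicalGroup G] : ℕ :=
  Module.finrank (ZMod p) (ZMod p ⊗[ℤ] Additive (TopologicalAbelianization G))

/-- The closed normal subgroup generated by a set. -/
def closedNormalClosure {G : Type u} [Group G] [TopologicalSpace G] [IsTopologicalGroup G]
    (T : Set G) : Subgroup G :=
  (Subgroup.normalClosure T).topologicalClosure

instance closedNormalClosure_normal {G : Type u} [Group G] [TopologicalSpace G]
    [IsTopologicalGroup G] (T : Set G) : (closedNormalClosure T).Normal :=
  Subgroup.is_normal_topologicalClosure _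

section CompletedGroupAlgebra

variable (p : ℕ) (G : Type u) [Group G] [TopologicalSpace G]

/-- The completed group algebra `𝔽_p⟦G⟧`, the inverse limit of the group algebras `𝔽_p[G / U]` over
the open normal subgroups `U` of `G`, realized as the ring of compatible families. -/
def completedGroupAlgebra :
    Subring (∀ U : OpenNormalSubgroup G, MonoidAlgebra (ZMod p) (G ⧸ U.toSubgroup)) where
  carrier := {a | ∀ (U V : OpenNormalSubgroup G) (h : U.toSubgroup ≤ V.toSubgroup.comap (MonoidHom.id G)),
    MonoidAlgebra.mapDomainRingHom (ZMod p)
      (QuotientGroup.map U.toSubgroup V.toSubgroup (MonoidHom.id G) h) (a U) = a V}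
  zero_mem' := fun U V h => by simp
  one_mem' := fun U V h => by
    rw [Pi.one_apply, Pi.one_apply, map_one]
  add_mem' := fun ha hb U V h => by
    rw [Pi.add_apply, Pi.add_apply, map_add, ha U V h, hb U V h]
  mul_mem' := fun ha hb U V h => by
    rw [Pi.mul_apply, Pi.mul_apply, map_mul, ha U V h, hb U V h]
  neg_mem' := fun ha U V h => by
    rw [Pi.neg_apply, Pi.neg_apply, map_neg, ha U V h]

/-- The trivial quotient `G / G`, at which the augmentation of `𝔽_p⟦G⟧` is read off. -/
def topOpenNormal : OpenNormalSubgroup G where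
  toOpenSubgroup := ⊤
  isNormal' := inferInstanceAs (⊤ : Subgroup G).Normal

/-- The augmentation `𝔽_p⟦G⟧ → 𝔽_p`: the sum of the coefficients of the component in
`𝔽_p[G / G]` (by compatibility, every component has the same sum of coefficients). -/
def augmentation : completedGroupAlgebra p G →+* ZMod p :=
  ((MonoidAlgebra.lift (ZMod p) (ZMod p) (G ⧸ (topOpenNormal G).toSubgroup) 1).toRingHom.comp
    (Pi.evalRingHom _ (topOpenNormal G))).comp (completedGroupAlgebra p G).subtype

/-- The augmentation ideal `I` of `𝔽_p⟦G⟧`. -/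
def augmentationIdeal : Ideal (completedGroupAlgebra p G) :=
  RingHom.ker (augmentation p G)

variable {G}

/-- The canonical map `G → 𝔽_p⟦G⟧`. -/
def groupLike (g : G) : completedGroupAlgebra p G :=
  ⟨fun U => MonoidAlgebra.of (ZMod p) (G ⧸ U.toSubgroup) (QuotientGroup.mk g), fun U V h => by
    simp⟩

/-- The depth `ω(g) = max {n | g - 1 ∈ I ^ n}` of `g`, with `ω(1) = ∞`. -/
def depth (g : G) : ℕ∞ :=
  ⨆ n : {n : ℕ // groupLike p g - 1 ∈ augmentationIdeal p G ^ n}, ((n : ℕ) : ℕ∞)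

end CompletedGroupAlgebra

/-- A minimal presentation `1 → R → F → G → 1` of `G`: a continuous epimorphism `φ` onto `G` from
the free pro-`p` group `F` on `d` generators, `d` being the `p`-rank of `G`, with a set of relators
which generates `R = ker φ` as a closed normal subgroup and has only finitely many members of each
finite depth. -/
structure MinimalPresentation (p : ℕ) [Fact p.Prime] (F : Type u) (G : Type v)
    [Group F] [TopologicalSpace F] [IsTopologicalGroup F]
    [Group G] [TopologicalSpace G] [IsTopologicalGroup G] where
  d : ℕ
  basis : Fin d → F
  free : IsFreeProP p basis
  φ : F →ₜ* G
  surjective : Function.Surjective φ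
  minimal : d = pRank p G
  relators : Set F
  ker_eq : φ.toMonoidHom.ker = closedNormalClosure relators
  finite_depth : ∀ k : ℕ, {ρ ∈ relators | depth p ρ = k}.Finite

namespace MinimalPresentation

variable {p : ℕ} [Fact p.Prime] {F : Type u} {G : Type v}
  [Group F] [TopologicalSpace F] [IsTopologicalGroup F]
  [Group G] [TopologicalSpace G] [IsTopologicalGroup G]

/-- The subgroup `R` of the presentation. -/
abbrev R (P : MinimalPresentation p F G) : Subgroup F := P.φ.toMonoidHom.ker

/-- The number `r_k` of relators of depth `k`. -/
def r (P : MinimalPresentation p F G) (k : ℕ) : ℕ := {ρ ∈ P.relators | depth p ρ = k}.ncard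

/-- The Golod-Shafarevich series `1 - d t + ∑_{k ≥ 2} r_k t ^ k`. -/
def series (P : MinimalPresentation p F G) : PowerSeries ℝ :=
  PowerSeries.mk fun k => if k = 0 then 1 else if k = 1 then -(P.d : ℝ) else (P.r k : ℝ)

/-- The Golod-Shafarevich series converges at `t`. -/
def ConvergesAt (P : MinimalPresentation p F G) (t : ℝ) : Prop :=
  Summable fun k : ℕ => PowerSeries.coeff k P.series * t ^ k

/-- The value of the Golod-Shafarevich series at `t`, when it converges there. -/
def value (P : MinimalPresentation p F G) (t : ℝ) : ℝ :=
  ∑' k : ℕ, PowerSeries.coeff k P.series * t ^ k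

/-- The closed normal subgroup of `F` generated by `R` and `T`. -/
def addRelations (P : MinimalPresentation p F G) (T : Set F) : Subgroup F :=
  closedNormalClosure ((P.R : Set F) ∪ T)

instance addRelations_normal (P : MinimalPresentation p F G) (T : Set F) :
    (P.addRelations T).Normal :=
  closedNormalClosure_normal _

/-- The image under `φ` of the closed normal subgroup of `F` generated by `T`. -/
def cut (P : MinimalPresentation p F G) (T : Set F) : Subgroup G :=
  (closedNormalClosure T).map P.φ.toMonoidHom

instance cut_normal (P : MinimalPresentation p F G) (T : Set F) : (P.cut T).Normal :=
  (closedNormalClosure_normal T).map _ P.surjective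

end MinimalPresentation

end GolodShafarevich

end

/-! The engine is the Golod–Shafarevich argument. Let A be the free associative algebra over 𝔽_p on
d variables and M its ideal of polynomials without constant term. The Magnus map x_i ↦ 1 + X_i sends
F into the units of A/M^(N+1), and elements of depth at least k into 1 + M^k
(`IsFreeProP.exists_magnus`). The relators thus give elements g_i of M^(ℓ i). Let c_n be the
dimension of A modulo the g_i and M^n. Fox calculus yields 1 + d c_n ≤ c_(n+1) + ∑ c_(n+1-ℓ i)
(`golodShafarevich_inequality`). If 1 - dt + ∑ t^(ℓ i) ≤ 0 for some t in (0,1), weighted summation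
forces t ≤ t^N c_N (`le_pow_mul_of_inequality`), so c_N is unbounded. The quotient group spans each
truncation, so its order bounds every c_N; hence it is infinite (`IsFreeProP.infinite_quotient`).

The series ignores relators of depth below 2, so it must be shown that there are none. This is where
minimality enters: `MinimalPresentation.two_le_depth` proves R - 1 ⊆ I². New relators then add at
most t₀^k, respectively ∑ t₀^(k'+i) = t₀^k'/(1 - t₀), to a negative value.

The isomorphism is formal: the preimage of φ(N) is NR, which is closed by compactness, and a
continuous bijection from a compact to a Hausdorff space is a homeomorphism. -/

noncomputable section

namespace GolodShafarevich

universe u v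

section QuotientFactor

variable {K R : Type*} [Field K] [Ring R] [Algebra K R] {I J : Ideal R}

theorem finite_quotient_of_le (h : I ≤ J) [Module.Finite K (R ⧸ I)] : Module.Finite K (R ⧸ J) :=
  Module.Finite.of_surjective ((Submodule.factor h).restrictScalars K)
    (Submodule.factor_surjective h)

end QuotientFactor

/-! ### Fox calculus and the Golod–Shafarevich inequality in the free algebra. -/

section FreeAlgebra

variable (K : Type*) [Field K] (d : ℕ)

/-- The constant coefficient of a noncommutative polynomial. -/
abbrev constantCoeff {K : Type*} [Field K] {d : ℕ} : FreeAlgebra K (Fin d) →ₐ[K] K :=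
  FreeAlgebra.algebraMapInv

/-- The ideal of noncommutative polynomials without constant term. -/
def irrelevantIdeal : Ideal (FreeAlgebra K (Fin d)) :=
  RingHom.ker (constantCoeff : FreeAlgebra K (Fin d) →ₐ[K] K)

instance irrelevantIdeal_isTwoSided : (irrelevantIdeal K d).IsTwoSided :=
  inferInstanceAs (RingHom.ker _).IsTwoSided

variable {K d}

theorem mem_irrelevantIdeal {a : FreeAlgebra K (Fin d)} :
    a ∈ irrelevantIdeal K d ↔ constantCoeff a = 0 :=
  Iff.rfl

theorem constantCoeff_ι (i : Fin d) : constantCoeff (FreeAlgebra.ι K i) = 0 := by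
  simp [FreeAlgebra.algebraMapInv]

theorem ι_mem_irrelevantIdeal (i : Fin d) : FreeAlgebra.ι K i ∈ irrelevantIdeal K d :=
  constantCoeff_ι i

/-- The Fox derivatives, as the upper right entries of an upper triangular representation. -/
def foxHom (j : Fin d) :
    FreeAlgebra K (Fin d) →ₐ[K] Matrix (Fin 2) (Fin 2) (FreeAlgebra K (Fin d)) :=
  FreeAlgebra.lift K fun i => !![FreeAlgebra.ι K i, if i = j then 1 else 0; 0, 0]

theorem foxHom_eq (j : Fin d) (a : FreeAlgebra K (Fin d)) :
    foxHom j a 0 0 = a ∧ foxHom j a 1 0 = 0 ∧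
      foxHom j a 1 1 = algebraMap K (FreeAlgebra K (Fin d)) (constantCoeff a) := by
  induction a using FreeAlgebra.induction with
  | grade0 r => simp [Matrix.algebraMap_matrix_apply]
  | grade1 i => simp [foxHom, constantCoeff_ι]
  | mul a b ha hb =>
    simp [Matrix.mul_apply, Fin.sum_univ_two, ha.1, ha.2.1, ha.2.2, hb.1, hb.2.1, hb.2.2]
  | add a b ha hb => simp [ha.1, ha.2.1, ha.2.2, hb.1, hb.2.1, hb.2.2]

/-- The Fox derivative with respect to the `j`-th variable, characterized by
`a = constantCoeff a + ∑ j, fox j a * X j`. -/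
def fox (j : Fin d) : FreeAlgebra K (Fin d) →ₗ[K] (FreeAlgebra K (Fin d)) where
  toFun a := foxHom j a 0 1
  map_add' a b := by simp
  map_smul' r a := by simp

theorem fox_mul (j : Fin d) (a b : FreeAlgebra K (Fin d)) :
    fox j (a * b) = a * fox j b + constantCoeff b • fox j a := by
  simp only [fox, LinearMap.coe_mk, AddHom.coe_mk, map_mul, Matrix.mul_apply, Fin.sum_univ_two]
  rw [(foxHom_eq j a).1, (foxHom_eq j b).2.2, ← Algebra.commutes, Algebra.smul_def]

theorem fox_algebraMap (j : Fin d) (r : K) :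
    fox j (algebraMap K (FreeAlgebra K (Fin d)) r) = 0 := by
  simp [fox, Matrix.algebraMap_matrix_apply]

theorem fox_ι (i j : Fin d) : fox j (FreeAlgebra.ι K i) = if i = j then 1 else 0 := by
  simp [fox, foxHom]

theorem eq_sum_fox (a : FreeAlgebra K (Fin d)) :
    a = algebraMap K (FreeAlgebra K (Fin d)) (constantCoeff a) + ∑ j,
        fox j a * FreeAlgebra.ι K j := by
  induction a using FreeAlgebra.induction with
  | grade0 r => simp [fox_algebraMap]
  | grade1 i => simp [fox_ι, constantCoeff_ι]
  | add a b ha hb =>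
    nth_rw 1 [ha, hb]
    simp only [map_add, add_mul, Finset.sum_add_distrib]
    abel
  | mul a b ha hb =>
    simp only [fox_mul, add_mul, Finset.sum_add_distrib, mul_assoc, ← Finset.mul_sum,
        smul_mul_assoc,
      ← Finset.smul_sum]
    rw [eq_sub_iff_add_eq'.2 ha.symm, eq_sub_iff_add_eq'.2 hb.symm, map_mul, Algebra.smul_def,
      mul_sub, mul_sub, ← Algebra.commutes (constantCoeff b) a,
      mul_comm (constantCoeff a), map_mul]
    abel

/-- In a product x * y with y in the irrelevant ideal, the term of `fox_mul` carrying `constantCoeff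
y` vanishes, so only the last factor is lost. -/
theorem fox_mem_pow {n : ℕ} (j : Fin d) {a : FreeAlgebra K (Fin d)} (ha : a ∈
    irrelevantIdeal K d ^ (n + 1)) : fox j a ∈ irrelevantIdeal K d ^ n := by
  rw [Submodule.pow_succ] at ha
  refine Submodule.mul_induction_on ha (fun x hx y hy => ?_) fun x y hx hy => ?_
  · rw [fox_mul, mem_irrelevantIdeal.1 hy, zero_smul, add_zero]
    exact Ideal.mul_mem_right _ _ hx
  · rw [map_add]
    exact add_mem hx hy

theorem mem_pow_mul {m n : ℕ} {a b : FreeAlgebra K (Fin d)} (ha : a ∈ irrelevantIdeal K d ^ m)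
    (hb : b ∈ irrelevantIdeal K d ^ n) : a * b ∈ irrelevantIdeal K d ^ (m + n) := by
  rw [Ideal.IsTwoSided.pow_add]
  exact Ideal.mul_mem_mul ha hb

/-- By `eq_sum_fox`, a class modulo the power n + 1 is recovered from its constant coefficient and
the classes of its d Fox derivatives modulo the power n. -/
instance finite_quotient_pow (n : ℕ) :
    Module.Finite K (FreeAlgebra K (Fin d) ⧸ irrelevantIdeal K d ^ n) := by
  induction n with
  | zero =>
    have : Subsingleton (FreeAlgebra K (Fin d) ⧸ irrelevantIdeal K d ^ 0) := by
      rw [Submodule.pow_zero, Ideal.one_eq_top]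
      exact Submodule.Quotient.subsingleton_iff.2 rfl
    infer_instance
  | succ n ih =>
    have hX (j : Fin d) : irrelevantIdeal K d ^ n ≤ Submodule.comap
        (LinearMap.toSpanSingleton (FreeAlgebra K (Fin d)) (FreeAlgebra K (Fin d))
            (FreeAlgebra.ι K j)) (irrelevantIdeal K d ^ (n + 1)) := fun a ha =>
      mem_pow_mul ha ((Submodule.pow_one (irrelevantIdeal K d)).symm ▸ ι_mem_irrelevantIdeal j)
    let f (j : Fin d) : (FreeAlgebra K (Fin d) ⧸ irrelevantIdeal K d ^ n) →ₗ[K]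
        (FreeAlgebra K (Fin d) ⧸ irrelevantIdeal K d ^ (n + 1)) :=
      (Submodule.mapQ (irrelevantIdeal K d ^ n) (irrelevantIdeal K d ^ (n + 1))
          (LinearMap.toSpanSingleton (FreeAlgebra K (Fin d)) (FreeAlgebra K (Fin d))
          (FreeAlgebra.ι K j))
        (hX j)).restrictScalars K
    let g : K →ₗ[K] (FreeAlgebra K (Fin d) ⧸ irrelevantIdeal K d ^ (n + 1)) :=
      ((irrelevantIdeal K d ^ (n + 1)).mkQ.restrictScalars K).comp (Algebra.linearMap K
          (FreeAlgebra K (Fin d)))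
    refine Module.Finite.of_surjective
      (LinearMap.coprod g (LinearMap.lsum K (fun _ :
          Fin d => FreeAlgebra K (Fin d) ⧸ irrelevantIdeal K d ^ n) K f)) fun y => ?_
    obtain ⟨a, rfl⟩ := Submodule.mkQ_surjective _ y
    refine ⟨(constantCoeff a, fun j => (irrelevantIdeal K d ^ n).mkQ (fox j a)), ?_⟩
    conv_rhs => rw [eq_sum_fox a]
    simp only [f, g, LinearMap.coprod_apply, LinearMap.lsum_apply, map_add, map_sum]
    rw [LinearMap.sum_apply]
    rfl

/-- The two-sided ideal generated by a family, as a left ideal. -/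
def relationIdeal {ι : Type*} (g : ι → FreeAlgebra K (Fin d)) : Ideal (FreeAlgebra K (Fin d)) :=
  Ideal.span {x | ∃ i b, x = g i * b}

variable {ι : Type*} (g : ι → FreeAlgebra K (Fin d))

instance relationIdeal_isTwoSided : (relationIdeal g).IsTwoSided := by
  refine ⟨fun {a} b ha => ?_⟩
  refine Submodule.span_induction (p := fun x _ => x * b ∈ relationIdeal g) ?_ (by simp) ?_ ?_ ha
  · rintro _ ⟨i, c, rfl⟩
    exact Ideal.subset_span ⟨i, c * b, mul_assoc _ _ _⟩
  · intro x y _ _ hx hy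
    rw [add_mul]
    exact add_mem hx hy
  · intro r x _ hx
    rw [smul_eq_mul, mul_assoc]
    exact Ideal.mul_mem_left _ _ hx

theorem mem_relationIdeal (i : ι) : g i ∈ relationIdeal g :=
  Ideal.subset_span ⟨i, 1, (mul_one _).symm⟩

/-- The ideal cutting out the truncation in degree `n` of the algebra with relators `g`. -/
def truncationIdeal (n : ℕ) :
    Ideal (FreeAlgebra K (Fin d)) := relationIdeal g ⊔ irrelevantIdeal K d ^ n

theorem pow_le_truncationIdeal (n : ℕ) : irrelevantIdeal K d ^ n ≤ truncationIdeal g n := by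
  rw [truncationIdeal]
  exact le_sup_right

instance truncationIdeal_isTwoSided (n : ℕ) : (truncationIdeal g n).IsTwoSided := by
  refine ⟨fun {a} b ha => ?_⟩
  obtain ⟨x, hx, y, hy, rfl⟩ := Submodule.mem_sup.1 ha
  rw [add_mul]
  exact Submodule.add_mem_sup (Ideal.mul_mem_right _ _ hx) (Ideal.mul_mem_right _ _ hy)

instance finite_truncation (n : ℕ) :
    Module.Finite K (FreeAlgebra K (Fin d) ⧸ truncationIdeal g n) :=
  finite_quotient_of_le (pow_le_truncationIdeal g n)

/-- The dimension of the truncation in degree `n` of the algebra with relators `g`. -/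
def truncationDim (n : ℕ) : ℕ := Module.finrank K (FreeAlgebra K (Fin d) ⧸ truncationIdeal g n)

theorem truncationDim_zero : truncationDim g 0 = 0 := by
  have : Subsingleton (FreeAlgebra K (Fin d) ⧸ truncationIdeal g 0) := by
    rw [truncationIdeal, Submodule.pow_zero, Ideal.one_eq_top, sup_top_eq]
    exact Submodule.Quotient.subsingleton_iff.2 rfl
  exact Module.finrank_zero_of_subsingleton

variable (ℓ : ι → ℕ) (hg : ∀ i, g i ∈ irrelevantIdeal K d ^ ℓ i) (hℓ : ∀ i, 1 ≤ ℓ i)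

/-- The classes of the Fox derivatives of an element in the truncation in degree `n`. -/
def foxClass (n : ℕ) :
    FreeAlgebra K (Fin d) →ₗ[K] (Fin d → FreeAlgebra K (Fin d) ⧸ truncationIdeal g n) :=
  LinearMap.pi fun j => ((truncationIdeal g n).mkQ.restrictScalars K).comp (fox j)

/-- The submodule generated by the Fox derivatives of the relators in a finite set. -/
def foxSpan (s : Finset ι) (n : ℕ) :
    Submodule (FreeAlgebra K (Fin d)) (Fin d → FreeAlgebra K (Fin d) ⧸ truncationIdeal g n) :=
  ⨆ i ∈ s, LinearMap.range (LinearMap.toSpanSingleton (FreeAlgebra K (Fin d)) _ (foxClass g n (g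
      i)))

-- The map a ↦ a • `foxClass g n (g i)` factors through the truncation in degree n + 1 - ℓ i,
-- because the Fox derivatives of g i already have order ℓ i - 1.
include hg hℓ in
theorem finrank_range_toSpanSingleton_le (i : ι) (n : ℕ) :
    Module.finrank K ((LinearMap.range (LinearMap.toSpanSingleton (FreeAlgebra K (Fin d)) _
      (foxClass g n (g i)))).restrictScalars K) ≤ truncationDim g (n + 1 - ℓ i) := by
  set f := LinearMap.toSpanSingleton (FreeAlgebra K (Fin d)) _ (foxClass g n (g i))
  have hk : truncationIdeal g (n + 1 - ℓ i) ≤ LinearMap.ker f := by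
    intro a ha
    rw [LinearMap.mem_ker]
    ext j
    change Submodule.Quotient.mk (a * fox j (g i)) = 0
    rw [Submodule.Quotient.mk_eq_zero]
    obtain ⟨x, hx, y, hy, rfl⟩ := Submodule.mem_sup.1 ha
    rw [add_mul]
    refine Submodule.add_mem_sup (Ideal.mul_mem_right _ _ hx) ?_
    have h1 : fox j (g i) ∈ irrelevantIdeal K d ^ (ℓ i - 1) :=
      fox_mem_pow j (by rw [Nat.sub_add_cancel (hℓ i)]; exact hg i)
    -- The order is at least (n + 1 - ℓ i) + (ℓ i - 1) ≥ n, also when ℓ i > n + 1 and the truncated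
    -- difference is 0.
    exact Ideal.pow_le_pow_right (by have := hℓ i; omega) (mem_pow_mul hy h1)
  have hr : (LinearMap.range f).restrictScalars K =
      LinearMap.range ((Submodule.liftQ _ f hk).restrictScalars K) := by
    ext x
    simp only [Submodule.restrictScalars_mem, LinearMap.mem_range, LinearMap.restrictScalars_apply]
    constructor
    · rintro ⟨a, rfl⟩
      exact ⟨Submodule.Quotient.mk a, rfl⟩
    · rintro ⟨y, rfl⟩
      obtain ⟨a, rfl⟩ := Submodule.mkQ_surjective _ y
      exact ⟨a, rfl⟩
  rw [hr]
  exact LinearMap.finrank_range_le _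

include hg hℓ in
theorem finrank_foxSpan_le (s : Finset ι) (n : ℕ) :
    Module.finrank K ((foxSpan g s n).restrictScalars K) ≤
      ∑ i ∈ s, truncationDim g (n + 1 - ℓ i) := by
  classical
  induction s using Finset.induction_on with
  | empty =>
    have : foxSpan g ∅ n = ⊥ := by simp [foxSpan]
    rw [this, Submodule.restrictScalars_bot, finrank_bot, Finset.sum_empty]
  | insert i s hi ih =>
    have : (foxSpan g (insert i s) n).restrictScalars K =
        (LinearMap.range (LinearMap.toSpanSingleton (FreeAlgebra K (Fin d)) _
          (foxClass g n (g i)))).restrictScalars K ⊔ (foxSpan g s n).restrictScalars K := by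
      rw [foxSpan, Finset.iSup_insert, ← foxSpan, Submodule.restrictScalars_sup]
    rw [this, Finset.sum_insert hi]
    exact (Submodule.finrank_add_le_finrank_add_finrank _ _).trans
      (add_le_add (finrank_range_toSpanSingleton_le g ℓ hg hℓ i n) ih)

-- Modulo the relation ideal, the Fox derivatives of r * g i * b reduce to the scalar `constantCoeff
-- b` times r * fox (g i). Relators of order at least n + 1 contribute nothing in degree n, so a
-- finite set s suffices.
include hg hℓ in
theorem foxClass_mem_foxSpan (s : Finset ι) (n : ℕ) (hs : ∀ i ∉ s, n + 1 ≤ ℓ i) {a :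
    FreeAlgebra K (Fin d)}
    (ha : a ∈ truncationIdeal g (n + 1)) : foxClass g n a ∈ foxSpan g s n := by
  have hM (x : FreeAlgebra K (Fin d)) (hx : x ∈ irrelevantIdeal K d ^ (n + 1)) :
      foxClass g n x = 0 := by
    ext j
    change Submodule.Quotient.mk (fox j x) = 0
    rw [Submodule.Quotient.mk_eq_zero]
    exact Submodule.mem_sup_right (fox_mem_pow j hx)
  have hr (i : ι) : g i ∈ irrelevantIdeal K d := Ideal.pow_le_self (by have := hℓ i; omega) (hg i)
  have hg' (i : ι) : foxClass g n (g i) ∈ foxSpan g s n := by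
    by_cases hi : i ∈ s
    · exact Submodule.mem_iSup_of_mem i (Submodule.mem_iSup_of_mem hi ⟨1, by simp⟩)
    · rw [hM _ (Ideal.pow_le_pow_right (hs i hi) (hg i))]
      exact zero_mem _
  obtain ⟨x, hx, y, hy, rfl⟩ := Submodule.mem_sup.1 ha
  rw [map_add, hM y hy, add_zero]
  have hεx : ∀ x ∈ relationIdeal g, constantCoeff x = 0 := by
    intro x hx
    refine (Ideal.span_le (I := irrelevantIdeal K d)).2 ?_ hx
    rintro _ ⟨i, b, rfl⟩
    exact Ideal.mul_mem_right _ _ (hr i)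
  refine Submodule.span_induction (p := fun x _ => foxClass g n x ∈ foxSpan g s n)
    ?_ (by simp) ?_ ?_ hx
  · rintro _ ⟨i, b, rfl⟩
    have : foxClass g n (g i * b) = constantCoeff b • foxClass g n (g i) := by
      ext j
      change Submodule.Quotient.mk (fox j (g i * b)) =
        constantCoeff b • (Submodule.Quotient.mk (fox j (g i)) :
            FreeAlgebra K (Fin d) ⧸ truncationIdeal g n)
      rw [fox_mul, Submodule.Quotient.mk_add, (Submodule.Quotient.mk_eq_zero _).2, zero_add]
      · rfl
      · exact Submodule.mem_sup_left (Ideal.mul_mem_right _ _ (mem_relationIdeal g i))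
    rw [this]
    exact ((foxSpan g s n).restrictScalars K).smul_mem _ (hg' i)
  · intro x y _ _ hx hy
    rw [map_add]
    exact add_mem hx hy
  · intro r x hxg hx
    have : foxClass g n (r • x) = r • foxClass g n x := by
      ext j
      change Submodule.Quotient.mk (fox j (r * x)) =
        r • (Submodule.Quotient.mk (fox j x) : FreeAlgebra K (Fin d) ⧸ truncationIdeal g n)
      rw [fox_mul, hεx x hxg, zero_smul, add_zero]
      rfl
    rw [this]
    exact (foxSpan g s n).smul_mem _ hx

include hg hℓ in
/-- The Golod-Shafarevich inequality for the dimensions of the truncations. -/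
theorem golodShafarevich_inequality (s : Finset ι) (n : ℕ) (hs : ∀ i ∉ s, n + 1 ≤ ℓ i) :
    1 + d * truncationDim g n ≤
      truncationDim g (n + 1) + ∑ i ∈ s, truncationDim g (n + 1 - ℓ i) := by
  set S := (foxSpan g s n).restrictScalars K with hS
  -- Φ is onto and kills the truncation ideal of degree n + 1, so the dimension of its target, at
  -- least 1 + d c_n - ∑ c_(n+1-ℓ i), is at most c_(n+1).
  let Φ : FreeAlgebra K (Fin d) →ₗ[K] K × ((Fin d →
      FreeAlgebra K (Fin d) ⧸ truncationIdeal g n) ⧸ S) :=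
    LinearMap.prod constantCoeff.toLinearMap (S.mkQ.comp (foxClass g n))
  have hker : (truncationIdeal g (n + 1)).restrictScalars K ≤ LinearMap.ker Φ := by
    intro a ha
    rw [LinearMap.mem_ker]
    refine Prod.ext ?_ ?_
    · change constantCoeff a = 0
      have h : truncationIdeal g (n + 1) ≤ irrelevantIdeal K d := by
        rw [truncationIdeal]
        refine sup_le ?_ (Ideal.pow_le_self n.succ_ne_zero)
        refine Ideal.span_le.2 ?_
        rintro _ ⟨i, b, rfl⟩
        exact Ideal.mul_mem_right _ _ (Ideal.pow_le_self (by have := hℓ i; omega) (hg i))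
      exact h ha
    · exact (Submodule.Quotient.mk_eq_zero _).2 (foxClass_mem_foxSpan g ℓ hg hℓ s n hs ha)
  have hsurj : Function.Surjective Φ := by
    rintro ⟨r, y⟩
    obtain ⟨v, rfl⟩ := S.mkQ_surjective y
    choose a ha using fun j => Submodule.mkQ_surjective _ (v j)
    -- The preimage is the Fox expansion with prescribed constant coefficient r and derivatives a j.
    refine ⟨algebraMap K (FreeAlgebra K (Fin d)) r + ∑ j, a j * FreeAlgebra.ι K j, Prod.ext ?_ ?_⟩
    · change constantCoeff (_ + _) = r
      simp [constantCoeff_ι]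
    · change S.mkQ (foxClass g n _) = _
      congr 1
      ext j
      change (truncationIdeal g n).mkQ (fox j _) = _
      rw [← ha j]
      congr 1
      simp [fox_algebraMap, fox_mul, fox_ι, constantCoeff_ι]
  have h1 := LinearMap.finrank_le_finrank_of_surjective
    (f := (Submodule.liftQ _ Φ hker).comp
      (Submodule.Quotient.restrictScalarsEquiv K (truncationIdeal g (n + 1))).symm.toLinearMap)
    (by
      rw [LinearMap.coe_comp]
      refine Function.Surjective.comp ?_ (LinearEquiv.surjective _)
      intro y
      obtain ⟨a, rfl⟩ := hsurj y
      exact ⟨Submodule.Quotient.mk a, rfl⟩)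
  have h2 := finrank_foxSpan_le g ℓ hg hℓ s n
  rw [← hS] at h2
  have h3 := S.finrank_quotient_add_finrank
  rw [Module.finrank_prod, Module.finrank_self] at h1
  rw [Module.finrank_pi_fintype, Finset.sum_const, Finset.card_univ, Fintype.card_fin, smul_eq_mul]
    at h3
  change _ ≤ truncationDim g (n + 1) at h1
  change _ = d * truncationDim g n at h3
  omega

end FreeAlgebra

/-! ### Growth of sequences satisfying the inequality. -/

section Growth

variable {ι : Type*}

theorem sum_shift_le {c : ℕ → ℝ} (hc : ∀ n, 0 ≤ c n) (hc0 : c 0 = 0) {t : ℝ} (ht : 0 ≤ t) {l : ℕ}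
    (hl : 1 ≤ l) (N : ℕ) :
    ∑ n ∈ Finset.range N, t ^ (n + 1) * c (n + 1 - l) ≤
      t ^ l * ∑ n ∈ Finset.range N, t ^ n * c n := by
  -- Terms with n + 1 < l have truncated index 0 and vanish since c 0 = 0; the others are shifted by
  -- l.
  have h : ∑ n ∈ Finset.range N, t ^ (n + 1) * c (n + 1 - l) =
      t ^ l * ∑ n ∈ Finset.range (N + 1 - l), t ^ n * c n := by
    induction N with
    | zero => simp [Nat.sub_eq_zero_of_le hl]
    | succ N ih =>
      rw [Finset.sum_range_succ, ih]
      rcases le_or_gt l (N + 1) with h | h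
      · rw [Nat.sub_add_comm h, Finset.sum_range_succ, mul_add, ← mul_assoc, ← pow_add,
          Nat.add_sub_cancel' h]
      · rw [Nat.sub_eq_zero_of_le h.le, hc0, Nat.sub_eq_zero_of_le h]
        simp
  rw [h]
  refine mul_le_mul_of_nonneg_left ?_ (pow_nonneg ht l)
  exact Finset.sum_le_sum_of_subset_of_nonneg (Finset.range_mono (by omega))
    fun n _ _ => mul_nonneg (pow_nonneg ht n) (hc n)

/-- A sequence subject to the Golod-Shafarevich inequality, with a series that is not positive at
`t`, grows at least as fast as `t ^ (1 - N)`. -/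
theorem le_pow_mul_of_inequality {c : ℕ → ℝ} (hc : ∀ n, 0 ≤ c n) (hc0 : c 0 = 0) {t : ℝ}
    (ht : 0 < t) (d : ℝ) {ℓ : ι → ℕ} (hℓ : ∀ i, 1 ≤ ℓ i) (s : Finset ι) {N : ℕ} (hN : 1 ≤ N)
    (h : ∀ n < N, 1 + d * c n ≤ c (n + 1) + ∑ i ∈ s, c (n + 1 - ℓ i))
    (hneg : 1 - d * t + ∑ i ∈ s, t ^ ℓ i ≤ 0) : t ≤ t ^ N * c N := by
  set S := ∑ n ∈ Finset.range N, t ^ n * c n with hS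
  have hS0 : 0 ≤ S := Finset.sum_nonneg fun n _ => mul_nonneg (pow_nonneg ht.le n) (hc n)
  have h1 : ∑ n ∈ Finset.range N, t ^ (n + 1) * (1 + d * c n) ≤
      ∑ n ∈ Finset.range N, t ^ (n + 1) * (c (n + 1) + ∑ i ∈ s, c (n + 1 - ℓ i)) :=
    Finset.sum_le_sum fun n hn =>
      mul_le_mul_of_nonneg_left (h n (Finset.mem_range.1 hn)) (pow_nonneg ht.le _)
  have h2 : ∑ n ∈ Finset.range N, t ^ (n + 1) * (1 + d * c n) =
      ∑ n ∈ Finset.range N, t ^ (n + 1) + d * t * S := by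
    rw [hS, Finset.mul_sum, ← Finset.sum_add_distrib]
    exact Finset.sum_congr rfl fun n _ => by ring
  have h3 : ∑ n ∈ Finset.range N, t ^ (n + 1) * (c (n + 1) + ∑ i ∈ s, c (n + 1 - ℓ i)) =
      ∑ n ∈ Finset.range N, t ^ (n + 1) * c (n + 1) +
        ∑ i ∈ s, ∑ n ∈ Finset.range N, t ^ (n + 1) * c (n + 1 - ℓ i) := by
    rw [Finset.sum_comm, ← Finset.sum_add_distrib]
    exact Finset.sum_congr rfl fun n _ => by rw [mul_add, Finset.mul_sum]
  have h4 : ∑ n ∈ Finset.range N, t ^ (n + 1) * c (n + 1) = S + t ^ N * c N := by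
    have := Finset.sum_range_succ' (fun n => t ^ n * c n) N
    rw [Finset.sum_range_succ, hc0] at this
    linarith
  have h5 : ∑ i ∈ s, ∑ n ∈ Finset.range N, t ^ (n + 1) * c (n + 1 - ℓ i) ≤
      (∑ i ∈ s, t ^ ℓ i) * S := by
    rw [Finset.sum_mul]
    exact Finset.sum_le_sum fun i _ => sum_shift_le hc hc0 ht.le (hℓ i) N
  have h6 : t ≤ ∑ n ∈ Finset.range N, t ^ (n + 1) := by
    have := Finset.single_le_sum (f := fun n => t ^ (n + 1)) (fun n _ => pow_nonneg ht.le (n + 1))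
      (Finset.mem_range.2 hN)
    simpa using this
  -- Altogether t ≤ (1 - d t + ∑ t ^ ℓ i) * S + t ^ N * c N, and the first summand is not positive.
  nlinarith [mul_nonpos_of_nonpos_of_nonneg hneg hS0]

end Growth

/-! ### Finite p-groups of units and lifts from the free pro-p group. -/

section CongruenceUnits

variable {R : Type*} [Ring R]

/-- The units of a ring congruent to `1` modulo a left ideal. -/
def congruenceUnits (I : Ideal R) : Subgroup Rˣ where
  carrier := {u | (u : R) - 1 ∈ I}
  one_mem' := by simp
  mul_mem' := fun {a b} ha hb => by
    have : ((a * b : Rˣ) : R) - 1 = a * ((b : R) - 1) + ((a : R) - 1) := by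
      rw [Units.val_mul]; noncomm_ring
    rw [Set.mem_ofPred_eq, this]
    exact add_mem (I.mul_mem_left _ hb) ha
  inv_mem' := fun {a} ha => by
    have : ((a⁻¹ : Rˣ) : R) - 1 = -((a⁻¹ : Rˣ) : R) * ((a : R) - 1) := by
      rw [mul_sub, neg_mul, Units.inv_mul]; noncomm_ring
    rw [Set.mem_ofPred_eq, this]
    exact I.mul_mem_left _ ha

/-- In characteristic p, u ^ p ^ N - 1 = (u - 1) ^ p ^ N, which is zero because p ^ N ≥ N. -/
theorem isPGroup_congruenceUnits (p : ℕ) [Fact p.Prime] [CharP R p] {I : Ideal R} {N : ℕ}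
    (hI : ∀ x ∈ I, x ^ N = 0) : IsPGroup p (congruenceUnits I) := by
  rintro ⟨u, hu⟩
  refine ⟨N, Subtype.ext (Units.ext ?_)⟩
  change (u : R) ^ p ^ N = 1
  have h : (u : R) ^ p ^ N - 1 = 0 := by
    have := sub_pow_char_pow_of_commute (p := p) (n := N) (Commute.one_right (u : R))
    rw [one_pow] at this
    rw [← this]
    exact pow_eq_zero_of_le (Nat.lt_pow_self (Fact.out : p.Prime).one_lt).le (hI _ hu)
  exact sub_eq_zero.1 h

end CongruenceUnits

section FreeLift

variable {p : ℕ} {F : Type u} [Group F] [TopologicalSpace F] [IsTopologicalGroup F]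

theorem isProP_of_finite [Fact p.Prime] {H : Type u} [Group H] [TopologicalSpace H]
    [DiscreteTopology H] [IsTopologicalGroup H] [Finite H] (hH : IsPGroup p H) : IsProP p H where
  compact := inferInstance
  hausdorff := inferInstance
  totallyDisconnected := inferInstance
  index_eq U := hH.index U.toSubgroup

theorem IsFreeProP.exists_lift [Fact p.Prime] {d : ℕ} {x : Fin d → F} (hx : IsFreeProP p x)
    {H : Type} [Group H] [Finite H] (hH : IsPGroup p H) (h : Fin d → H) :
    ∃ θ : F →* H, (∀ i, θ (x i) = h i) ∧ IsOpen (θ.ker : Set F) := by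
  -- `ULift` moves H to the universe in which the universal property of F is stated.
  let _ : TopologicalSpace (ULift.{u} H) := ⊥
  have : DiscreteTopology (ULift.{u} H) := ⟨rfl⟩
  have hU : IsPGroup p (ULift.{u} H) := hH.of_equiv MulEquiv.ulift.symm
  obtain ⟨ψ, hψ, -⟩ := hx.existsUnique_lift (ULift.{u} H) (isProP_of_finite hU) fun i => ⟨h i⟩
  refine ⟨MulEquiv.ulift.toMonoidHom.comp ψ.toMonoidHom, fun i => ?_, ?_⟩
  · change (ψ (x i)).down = h i
    rw [hψ]
  · have : (((MulEquiv.ulift.toMonoidHom.comp ψ.toMonoidHom : F →* H).ker : Set F)) =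
        ψ ⁻¹' {1} := by
      ext g
      change (ψ g).down = 1 ↔ ψ g = 1
      exact ⟨fun h => ULift.ext _ _ h, fun h => by rw [h]; rfl⟩
    rw [this]
    exact (isOpen_discrete _).preimage ψ.continuous_toFun

end FreeLift

/-! ### Representations of the completed group algebra, and depth. -/

section CompletedLift

variable {p : ℕ} {G : Type u} [Group G] [TopologicalSpace G]
  {R : Type v} [Ring R] [Algebra (ZMod p) R]

/-- The extension to the completed group algebra of a homomorphism with open kernel to the units of
an algebra. -/
def completedLift (θ : G →* Rˣ) (hθ : IsOpen (θ.ker : Set G)) : completedGroupAlgebra p G →+* R :=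
  ((MonoidAlgebra.lift (ZMod p) R (G ⧸ θ.ker)
    ((Units.coeHom R).comp (QuotientGroup.kerLift θ))).toRingHom.comp
    (Pi.evalRingHom (fun U : OpenNormalSubgroup G => MonoidAlgebra (ZMod p) (G ⧸ U.toSubgroup))
      { toSubgroup := θ.ker, isOpen' := hθ })).comp (completedGroupAlgebra p G).subtype

theorem completedLift_groupLike (θ : G →* Rˣ) (hθ : IsOpen (θ.ker : Set G)) (g : G) :
    completedLift (p := p) θ hθ (groupLike p g) = θ g := by
  change MonoidAlgebra.lift (ZMod p) R (G ⧸ θ.ker)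
    ((Units.coeHom R).comp (QuotientGroup.kerLift θ)) (MonoidAlgebra.of _ _ _) = _
  rw [MonoidAlgebra.lift_of]
  rfl

theorem augmentation_eq (a : completedGroupAlgebra p G) (U : OpenNormalSubgroup G) :
    augmentation p G a = MonoidAlgebra.lift (ZMod p) (ZMod p) (G ⧸ U.toSubgroup) 1 (a.1 U) := by
  have h := a.2 U (topOpenNormal G) (fun _ _ => trivial)
  change MonoidAlgebra.lift (ZMod p) (ZMod p) _ 1 (a.1 (topOpenNormal G)) = _
  rw [← h]
  generalize a.1 U = b
  induction b using MonoidAlgebra.induction_linear with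
  | zero => simp
  | add x y hx hy => rw [map_add, map_add, map_add, hx, hy]
  | single q r => simp [MonoidAlgebra.lift_single]

/-- Modulo I every θ g is 1, so the extension reduces to the sum of coefficients. -/
theorem completedLift_sub_mem (θ : G →* Rˣ) (hθ : IsOpen (θ.ker : Set G)) {I : Ideal R}
    (hI : ∀ g, (θ g : R) - 1 ∈ I) (a : completedGroupAlgebra p G) :
    completedLift θ hθ a - algebraMap (ZMod p) R (augmentation p G a) ∈ I := by
  have key (b : MonoidAlgebra (ZMod p) (G ⧸ θ.ker)) :
      MonoidAlgebra.lift (ZMod p) R (G ⧸ θ.ker)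
        ((Units.coeHom R).comp (QuotientGroup.kerLift θ)) b -
      algebraMap (ZMod p) R (MonoidAlgebra.lift (ZMod p) (ZMod p) (G ⧸ θ.ker) 1 b) ∈ I := by
    induction b using MonoidAlgebra.induction_linear with
    | zero => simp
    | add x y hx hy =>
      rw [map_add, map_add, map_add, add_sub_add_comm]
      exact add_mem hx hy
    | single q r =>
      obtain ⟨g, rfl⟩ := QuotientGroup.mk_surjective q
      rw [MonoidAlgebra.lift_single, MonoidAlgebra.lift_single]
      have : r • ((Units.coeHom R).comp (QuotientGroup.kerLift θ)) (g : G ⧸ θ.ker) -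
          algebraMap (ZMod p) R (r • (1 : (G ⧸ θ.ker) →* ZMod p) g) =
          algebraMap (ZMod p) R r * ((θ g : R) - 1) := by
        rw [Algebra.smul_def, mul_sub]
        simp
      rw [this]
      exact I.mul_mem_left _ (hI g)
  rw [augmentation_eq a { toSubgroup := θ.ker, isOpen' := hθ }]
  exact key (a.1 { toSubgroup := θ.ker, isOpen' := hθ })

theorem completedLift_mem (θ : G →* Rˣ) (hθ : IsOpen (θ.ker : Set G)) {I : Ideal R}
    (hI : ∀ g, (θ g : R) - 1 ∈ I) {a : completedGroupAlgebra p G}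
    (ha : a ∈ augmentationIdeal p G) : completedLift θ hθ a ∈ I := by
  have h := completedLift_sub_mem θ hθ hI a
  rwa [show augmentation p G a = 0 from ha, map_zero, sub_zero] at h

/-- `depth` is a supremum, possibly infinite, so membership in a given power is extracted from some
larger exponent. -/
theorem mem_pow_of_le_depth {k : ℕ} {g : G} (h : (k : ℕ∞) ≤ depth p g) :
    groupLike p g - 1 ∈ augmentationIdeal p G ^ k := by
  rcases k with _ | k
  · rw [Submodule.pow_zero, Ideal.one_eq_top]
    trivial
  have h' : (k : ℕ∞) < depth p g := lt_of_lt_of_le (by exact_mod_cast k.lt_succ_self) h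
  obtain ⟨⟨n, hn⟩, hk⟩ := lt_iSup_iff.1 h'
  exact Ideal.pow_le_pow_right (Nat.succ_le_of_lt (by exact_mod_cast hk)) hn

theorem le_depth_of_mem_pow {k : ℕ} {g : G} (h : groupLike p g - 1 ∈ augmentationIdeal p G ^ k) :
    (k : ℕ∞) ≤ depth p g :=
  le_iSup (fun n : {n : ℕ // groupLike p g - 1 ∈ augmentationIdeal p G ^ n} => ((n : ℕ) : ℕ∞))
    ⟨k, h⟩

theorem augmentation_groupLike (g : G) : augmentation p G (groupLike p g) = 1 := by
  change MonoidAlgebra.lift (ZMod p) (ZMod p) _ 1 (MonoidAlgebra.of _ _ _) = _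
  rw [MonoidAlgebra.lift_of]
  rfl

theorem groupLike_sub_one_mem (g : G) : groupLike p g - 1 ∈ augmentationIdeal p G := by
  change augmentation p G _ = 0
  rw [map_sub, augmentation_groupLike, map_one, sub_self]

/-- The canonical map to the completed group algebra, as a homomorphism. -/
def groupLikeHom (p : ℕ) (G : Type u) [Group G] [TopologicalSpace G] :
    G →* completedGroupAlgebra p G where
  toFun := groupLike p
  map_one' := Subtype.ext (funext fun U => map_one (MonoidAlgebra.of (ZMod p) (G ⧸ U.toSubgroup)))
  map_mul' g h := Subtype.ext (funext fun U =>
    map_mul (MonoidAlgebra.of (ZMod p) (G ⧸ U.toSubgroup)) (g : G ⧸ U.toSubgroup) h)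

end CompletedLift

/-! ### The Magnus representation and infinite quotients. -/

section Magnus

variable {p : ℕ} [Fact p.Prime] {F : Type u} [Group F] [TopologicalSpace F] [IsTopologicalGroup F]
  {d : ℕ} {x : Fin d → F}

/-- The truncated Magnus representation. -/
theorem IsFreeProP.exists_magnus (hx : IsFreeProP p x) (N : ℕ) :
    ∃ θ : F →* (FreeAlgebra (ZMod p) (Fin d) ⧸ irrelevantIdeal (ZMod p) d ^ (N + 1))ˣ,
      (∀ i, (θ (x i) : FreeAlgebra (ZMod p) (Fin d) ⧸ irrelevantIdeal (ZMod p) d ^ (N + 1)) =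
        1 + Ideal.Quotient.mk _ (FreeAlgebra.ι (ZMod p) i)) ∧
      IsOpen (θ.ker : Set F) ∧
      ∀ (k : ℕ) (g : F), (k : ℕ∞) ≤ depth p g → ∃ a ∈ irrelevantIdeal (ZMod p) d ^ k,
        Ideal.Quotient.mk (irrelevantIdeal (ZMod p) d ^ (N + 1)) a =
          (θ g : FreeAlgebra (ZMod p) (Fin d) ⧸ irrelevantIdeal (ZMod p) d ^ (N + 1)) - 1 := by
  set M := irrelevantIdeal (ZMod p) d
  let π := Ideal.Quotient.mk (M ^ (N + 1))
  have hπ : Function.Surjective π := Ideal.Quotient.mk_surjective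
  have mem_map {k : ℕ} {y : FreeAlgebra (ZMod p) (Fin d) ⧸ M ^ (N + 1)} :
      y ∈ (M ^ k).map π ↔ ∃ a ∈ M ^ k, π a = y :=
    Ideal.mem_map_iff_of_surjective π hπ
  have : Finite (FreeAlgebra (ZMod p) (Fin d) ⧸ M ^ (N + 1)) := Module.finite_of_finite (ZMod p)
  have hnil : ∀ y ∈ (M ^ 1).map π, y ^ (N + 1) = 0 := by
    intro y hy
    obtain ⟨a, ha, rfl⟩ := mem_map.1 hy
    rw [← map_pow]
    exact Ideal.Quotient.eq_zero_iff_mem.2 (Ideal.pow_mem_pow (by rwa [Submodule.pow_one] at ha) _)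
  have hι (i : Fin d) : π (FreeAlgebra.ι (ZMod p) i) ∈ (M ^ 1).map π :=
    Ideal.mem_map_of_mem π (by rw [Submodule.pow_one]; exact ι_mem_irrelevantIdeal i)
  have : Nontrivial (FreeAlgebra (ZMod p) (Fin d) ⧸ M ^ (N + 1)) := by
    refine Ideal.Quotient.nontrivial_iff.2 fun h => ?_
    have h1 : (1 : FreeAlgebra (ZMod p) (Fin d)) ∈ M :=
      Ideal.pow_le_self N.succ_ne_zero (h ▸ Submodule.mem_top)
    rw [mem_irrelevantIdeal, map_one] at h1
    exact one_ne_zero h1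
  have : CharP (FreeAlgebra (ZMod p) (Fin d) ⧸ M ^ (N + 1)) p :=
    charP_of_injective_algebraMap (algebraMap (ZMod p) _).injective p
  have hu (i : Fin d) : IsUnit (1 + π (FreeAlgebra.ι (ZMod p) i)) :=
    IsNilpotent.isUnit_one_add ⟨N + 1, hnil _ (hι i)⟩
  obtain ⟨θ, hθ, hopen⟩ := hx.exists_lift (isPGroup_congruenceUnits p hnil)
    (fun i => ⟨(hu i).unit, by
      change (1 + π (FreeAlgebra.ι (ZMod p) i)) - 1 ∈ (M ^ 1).map π
      rw [add_sub_cancel_left]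
      exact hι i⟩)
  let θ' := (congruenceUnits ((M ^ 1).map π)).subtype.comp θ
  have hopen' : IsOpen (θ'.ker : Set F) := by
    rw [MonoidHom.ker_comp_of_injective _ _ (Subgroup.subtype_injective _)]
    exact hopen
  refine ⟨θ', fun i => ?_, hopen', fun k g hg => ?_⟩
  · change (((θ (x i)).1 : _) : FreeAlgebra (ZMod p) (Fin d) ⧸ M ^ (N + 1)) = _
    rw [hθ]
    rfl
  -- The extension sends the augmentation ideal into the image of M, hence its powers into the
  -- images of the powers of M.
  · have hpow : ∀ k, ∀ b ∈ augmentationIdeal p F ^ k,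
        completedLift θ' hopen' b ∈ (M ^ k).map π := by
      intro k
      induction k with
      | zero =>
        intro b _
        obtain ⟨a, ha⟩ := hπ (completedLift θ' hopen' b)
        refine mem_map.2 ⟨a, ?_, ha⟩
        rw [Submodule.pow_zero, Ideal.one_eq_top]
        trivial
      | succ k ih =>
        intro b hb
        rw [Submodule.pow_succ] at hb
        refine Submodule.mul_induction_on hb (fun y hy z hz => ?_) fun y z hy hz => ?_
        · obtain ⟨a, ha, h1⟩ := mem_map.1 (ih y hy)
          obtain ⟨c, hc, h2⟩ := mem_map.1 (completedLift_mem θ' hopen' (fun g => (θ g).2) hz)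
          exact mem_map.2 ⟨a * c, mem_pow_mul ha hc, by rw [map_mul, map_mul, h1, h2]⟩
        · rw [map_add]
          exact add_mem hy hz
    have := hpow k _ (mem_pow_of_le_depth hg)
    rw [map_sub, map_one, completedLift_groupLike] at this
    exact mem_map.1 this

theorem closedNormalClosure_le {T : Set F} {L : Subgroup F} [L.Normal] (hL : IsClosed (L : Set F))
    (h : T ⊆ L) : closedNormalClosure T ≤ L :=
  Subgroup.topologicalClosure_minimal _ (Subgroup.normalClosure_le_normal h) hL

theorem subset_closedNormalClosure (T : Set F) : T ⊆ closedNormalClosure T :=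
  Subgroup.subset_normalClosure.trans (Subgroup.le_topologicalClosure _)

/-- The Golod-Shafarevich theorem for presentations of pro-`p` groups. -/
theorem IsFreeProP.infinite_quotient (hx : IsFreeProP p x) {ι : Type*} (f : ι → F) (ℓ : ι → ℕ)
    (hℓ : ∀ i, 1 ≤ ℓ i) (hf : ∀ i, (ℓ i : ℕ∞) ≤ depth p (f i)) (hfin : ∀ n, {i | ℓ i < n}.Finite)
    {t : ℝ} (ht : t ∈ Set.Ioo (0 : ℝ) 1)
    (hneg : ∀ s : Finset ι, 1 - d * t + ∑ i ∈ s, t ^ ℓ i ≤ 0) {T : Set F}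
    (hT : ∀ g ∈ T, g ∈ Set.range f ∨ depth p g = ⊤) : Infinite (F ⧸ closedNormalClosure T) := by
  by_contra hinf
  rw [not_infinite_iff_finite] at hinf
  set L := closedNormalClosure T with hL
  -- N is taken so large that the growth bound t ≤ t ^ (N + 1) * c (N + 1) is incompatible with c (N
  -- + 1) ≤ |F / L|.
  obtain ⟨N, hN⟩ : ∃ N : ℕ, t ^ (N + 1) * Nat.card (F ⧸ L) < t := by
    have := (tendsto_pow_atTop_nhds_zero_of_lt_one ht.1.le ht.2).mul_const (Nat.card (F ⧸ L) : ℝ)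
    rw [zero_mul, ← Filter.tendsto_add_atTop_iff_nat 1] at this
    exact (this.eventually (gt_mem_nhds ht.1)).exists
  obtain ⟨θ, hθ, hopen, hdepth⟩ := hx.exists_magnus N
  choose g hg hgθ using fun i => hdepth (ℓ i) (f i) (hf i)
  let π := Ideal.Quotient.factor (pow_le_truncationIdeal g (N + 1))
  let Ψ : F →* (FreeAlgebra (ZMod p) (Fin d) ⧸ truncationIdeal g (N + 1))ˣ :=
    (Units.map π.toMonoidHom).comp θ
  have hclosed : IsClosed (Ψ.ker : Set F) :=
    Subgroup.isClosed_of_isOpen _ (Subgroup.isOpen_mono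
      (fun y (hy : θ y = 1) => show Ψ y = 1 by simp [Ψ, hy]) hopen)
  have hLker : L ≤ Ψ.ker := by
    refine closedNormalClosure_le hclosed fun y hy => ?_
    change Ψ y = 1
    refine Units.ext (sub_eq_zero.1 ?_)
    change π (θ y) - 1 = 0
    rw [← map_one π, ← map_sub]
    rcases hT y hy with ⟨i, rfl⟩ | h
    · rw [← hgθ i]
      change Ideal.Quotient.mk (truncationIdeal g (N + 1)) (g i) = 0
      exact Ideal.Quotient.eq_zero_iff_mem.2 (Submodule.mem_sup_left (mem_relationIdeal g i))
    -- A relator of infinite depth is already trivial in the truncated algebra, so it needs no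
    -- index.
    · obtain ⟨a, ha, h1⟩ := hdepth (N + 1) y (h ▸ le_top)
      rw [← h1, Ideal.Quotient.eq_zero_iff_mem.2 ha, map_zero]
  -- The span of the image of a group is a subalgebra, and it contains each variable as X_i = Ψ(x_i)
  -- - 1.
  have hspan : Submodule.span (ZMod p) (Set.range fun q : F ⧸ L =>
      ((QuotientGroup.lift L Ψ hLker q : _ˣ) :
        FreeAlgebra (ZMod p) (Fin d) ⧸ truncationIdeal g (N + 1))) = ⊤ := by
    set S := MonoidHom.mrange ((Units.coeHom
      (FreeAlgebra (ZMod p)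
          (Fin d) ⧸ truncationIdeal g (N + 1))).comp (QuotientGroup.lift L Ψ hLker))
    have hadj := Algebra.adjoin_eq_span (ZMod p)
      (S : Set (FreeAlgebra (ZMod p) (Fin d) ⧸ truncationIdeal g (N + 1)))
    rw [Submonoid.closure_eq] at hadj
    change Submodule.span (ZMod p)
      (S : Set (FreeAlgebra (ZMod p) (Fin d) ⧸ truncationIdeal g (N + 1))) = ⊤
    rw [← hadj, Algebra.toSubmodule_eq_top, eq_top_iff]
    rintro y -
    obtain ⟨a, rfl⟩ := Ideal.Quotient.mkₐ_surjective (ZMod p) _ y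
    have hle : Algebra.adjoin (ZMod p) (Set.range (FreeAlgebra.ι (ZMod p))) ≤
        (Algebra.adjoin (ZMod p)
          (S : Set (FreeAlgebra (ZMod p) (Fin d) ⧸ truncationIdeal g (N + 1)))).comap
          (Ideal.Quotient.mkₐ (ZMod p) (truncationIdeal g (N + 1))) := by
      refine Algebra.adjoin_le ?_
      rintro _ ⟨i, rfl⟩
      change Ideal.Quotient.mk (truncationIdeal g (N + 1)) (FreeAlgebra.ι (ZMod p) i) ∈
        Algebra.adjoin (ZMod p)
          (S : Set (FreeAlgebra (ZMod p) (Fin d) ⧸ truncationIdeal g (N + 1)))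
      have h1 : Ideal.Quotient.mk (truncationIdeal g (N + 1)) (FreeAlgebra.ι (ZMod p) i) =
          π (θ (x i)) - 1 := by
        rw [hθ, map_add, map_one, add_sub_cancel_left]
        rfl
      rw [h1]
      exact sub_mem (Algebra.subset_adjoin ⟨(x i : F ⧸ L), rfl⟩) (one_mem _)
    rw [FreeAlgebra.adjoin_range_ι] at hle
    exact hle (Algebra.mem_top (x := a))
  have hcard : truncationDim g (N + 1) ≤ Nat.card (F ⧸ L) := by
    have := Fintype.ofFinite (F ⧸ L)
    have := finrank_range_le_card (R := ZMod p) (fun q : F ⧸ L =>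
      ((QuotientGroup.lift L Ψ hLker q : _ˣ) :
        FreeAlgebra (ZMod p) (Fin d) ⧸ truncationIdeal g (N + 1)))
    rw [Set.finrank, hspan, finrank_top] at this
    rwa [Nat.card_eq_fintype_card]
  have hgrow := le_pow_mul_of_inequality (c := fun n => (truncationDim g n : ℝ))
    (fun n => Nat.cast_nonneg _) (by simp [truncationDim_zero]) ht.1 d hℓ (hfin (N + 1)).toFinset
    N.succ_pos
    (fun n hn => by
      exact_mod_cast golodShafarevich_inequality g ℓ hg hℓ _ n fun i hi => by
        simp only [Set.Finite.mem_toFinset, Set.mem_ofPred_eq, not_lt] at hi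
        omega)
    (hneg _)
  have hle : t ^ (N + 1) * (truncationDim g (N + 1) : ℝ) ≤ t ^ (N + 1) * Nat.card (F ⧸ L) :=
    mul_le_mul_of_nonneg_left (by exact_mod_cast hcard) (pow_nonneg ht.1.le _)
  exact absurd (hgrow.trans hle) (not_le.2 hN)

end Magnus

/-! ### Topological generation by the basis, and a criterion for depth at least 2. -/

section Generation

variable {p : ℕ} [Fact p.Prime] {F : Type u} [Group F] [TopologicalSpace F] [IsTopologicalGroup F]
  {d : ℕ} {x : Fin d → F}

/-- An open normal U of C contains C ∩ H for some open normal H of F, so its index divides that of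
H. -/
theorem IsProP.subgroup (hF : IsProP p F) {C : Subgroup F} (hC : IsClosed (C : Set F)) :
    IsProP p C := by
  have := hF.compact
  have := hF.hausdorff
  have := hF.totallyDisconnected
  refine ⟨isCompact_iff_compactSpace.1 hC.isCompact, inferInstance, inferInstance, fun U => ?_⟩
  obtain ⟨V, hV, hVU⟩ := isOpen_induced_iff.1 U.isOpen'
  have h1 : (1 : F) ∈ V := by
    have : (1 : C) ∈ Subtype.val ⁻¹' V := by
      rw [hVU]
      exact U.one_mem
    exact this
  obtain ⟨H, hH⟩ := ProfiniteGrp.exist_openNormalSubgroup_sub_open_nhds_of_one hV h1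
  obtain ⟨n, hn⟩ := hF.index_eq H
  have hle : H.toSubgroup.subgroupOf C ≤ U.toSubgroup := by
    intro c hc
    have : c ∈ Subtype.val ⁻¹' V := hH hc
    rw [hVU] at this
    exact this
  have hdvd : U.toSubgroup.index ∣ p ^ n := by
    rw [← hn]
    exact (Subgroup.index_dvd_of_le hle).trans (Subgroup.relIndex_dvd_index_of_normal _ _)
  obtain ⟨m, -, hm⟩ := (Nat.dvd_prime_pow Fact.out).1 hdvd
  exact ⟨m, hm⟩

/-- A free pro-`p` group is topologically generated by its basis. -/
theorem IsFreeProP.eq_top_of_isClosed (hx : IsFreeProP p x) {C : Subgroup F}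
    (hC : IsClosed (C : Set F)) (h : ∀ i, x i ∈ C) : C = ⊤ := by
  obtain ⟨ψ, hψ, -⟩ := hx.existsUnique_lift C (hx.isProP.subgroup hC) fun i => ⟨x i, h i⟩
  -- The lift into C followed by the inclusion agrees with the identity on the basis, hence
  -- everywhere.
  have heq := (hx.existsUnique_lift F hx.isProP x).unique
    (y₁ := (⟨C.subtype, continuous_subtype_val⟩ : C →ₜ* F).comp ψ)
    (y₂ := ContinuousMonoidHom.id F) (fun i => congrArg Subtype.val (hψ i)) (fun i => rfl)
  refine eq_top_iff.2 fun g _ => ?_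
  have : ((ψ g : C) : F) = g := DFunLike.congr_fun heq g
  rw [← this]
  exact (ψ g).2

theorem isClosed_span_range {R : Type*} [Ring R] [TopologicalSpace R] [IsTopologicalRing R]
    [CompactSpace R] [T2Space R] (v : Fin d → R) :
    IsClosed (Ideal.span (Set.range v) : Set R) := by
  have h : (Ideal.span (Set.range v) : Set R) = Set.range fun a : Fin d → R => ∑ i, a i * v i := by
    ext y
    exact Submodule.mem_span_range_iff_exists_fun R
  rw [h]
  refine (isCompact_range ?_).isClosed
  fun_prop

/-- The elements `x i - 1` generate a left ideal that contains every `g - 1`. -/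
theorem IsFreeProP.exists_groupLike_sub_one_eq (hx : IsFreeProP p x) (g : F) :
    ∃ a : Fin d → completedGroupAlgebra p F,
      groupLike p g - 1 = ∑ i, a i * (groupLike p (x i) - 1) := by
  have := hx.isProP.compact
  -- With finite discrete factors the completed group algebra is compact, so its finitely generated
  -- left ideals are closed.
  let _ : ∀ U : OpenNormalSubgroup F, TopologicalSpace (MonoidAlgebra (ZMod p)
      (F ⧸ U.toSubgroup)) :=
    fun _ => ⊥
  have _ : ∀ U : OpenNormalSubgroup F, DiscreteTopology (MonoidAlgebra (ZMod p)
      (F ⧸ U.toSubgroup)) :=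
    fun _ => ⟨rfl⟩
  have _ : ∀ U : OpenNormalSubgroup F, Finite (F ⧸ U.toSubgroup) := fun U =>
    U.toSubgroup.quotient_finite_of_isOpen U.isOpen'
  have _ : ∀ U : OpenNormalSubgroup F, Finite (MonoidAlgebra (ZMod p) (F ⧸ U.toSubgroup)) :=
    fun _ => Module.finite_of_finite (ZMod p)
  have hclosed : IsClosed (completedGroupAlgebra p F : Set (∀ U : OpenNormalSubgroup F,
      MonoidAlgebra (ZMod p) (F ⧸ U.toSubgroup))) := by
    have : (completedGroupAlgebra p F : Set (∀ U : OpenNormalSubgroup F,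
        MonoidAlgebra (ZMod p) (F ⧸ U.toSubgroup))) =
        ⋂ (U : OpenNormalSubgroup F) (V : OpenNormalSubgroup F)
          (h : U.toSubgroup ≤ V.toSubgroup.comap (MonoidHom.id F)),
          {a | MonoidAlgebra.mapDomainRingHom (ZMod p)
            (QuotientGroup.map U.toSubgroup V.toSubgroup (MonoidHom.id F) h) (a U) = a V} := by
      ext a
      simp only [Set.mem_iInter]
      rfl
    rw [this]
    refine isClosed_iInter fun U => isClosed_iInter fun V => isClosed_iInter fun h => ?_
    exact isClosed_eq (continuous_of_discreteTopology.comp (continuous_apply U))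
        (continuous_apply V)
  have _ : CompactSpace (completedGroupAlgebra p F) :=
    isCompact_iff_compactSpace.1 hclosed.isCompact
  have hcont : Continuous (groupLike p : F → completedGroupAlgebra p F) := by
    refine Continuous.subtype_mk (continuous_pi fun U => ?_) _
    have : DiscreteTopology (F ⧸ U.toSubgroup) := QuotientGroup.discreteTopology U.isOpen'
    exact continuous_of_discreteTopology.comp QuotientGroup.continuous_mk
  let I : Ideal (completedGroupAlgebra p F) :=
    Ideal.span (Set.range fun i => groupLike p (x i) - 1)
  have hI : IsClosed (I : Set (completedGroupAlgebra p F)) := isClosed_span_range _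
  -- The g with g - 1 ∈ I form a closed subgroup containing the basis.
  let C : Subgroup F := (congruenceUnits I).comap (groupLikeHom p F).toHomUnits
  have hC : IsClosed (C : Set F) := hI.preimage (hcont.sub continuous_const)
  have htop : C = ⊤ := hx.eq_top_of_isClosed hC fun i => Ideal.subset_span ⟨i, rfl⟩
  have hg : groupLike p g - 1 ∈ I := by
    have : g ∈ C := htop ▸ Subgroup.mem_top g
    exact this
  obtain ⟨a, ha⟩ := (Submodule.mem_span_range_iff_exists_fun _).1 hg
  exact ⟨a, ha.symm⟩

/-- The homomorphism `c ↦ 1 + c ε` to the dual numbers. -/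
def dualNumberHom (p : ℕ) : Multiplicative (ZMod p) →* DualNumber (ZMod p) where
  toFun c := 1 + TrivSqZeroExt.inr c.toAdd
  map_one' := by simp
  map_mul' a b := by
    ext <;> simp [add_comm]

/-- Write g - 1 = ∑ a_i (x_i - 1). The representation y ↦ 1 + h_i(y) ε shows that h_i(g) is the
augmentation of a_i; if all vanish, then g - 1 lies in I². -/
theorem IsFreeProP.two_le_depth (hx : IsFreeProP p x) (h : Fin d → F →* Multiplicative (ZMod p))
    (hopen : ∀ i, IsOpen ((h i).ker : Set F))
    (hδ : ∀ i j, h i (x j) = Multiplicative.ofAdd (if i = j then 1 else 0)) {g : F}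
    (hg : ∀ i, h i g = 1) : (2 : ℕ∞) ≤ depth p g := by
  obtain ⟨a, ha⟩ := hx.exists_groupLike_sub_one_eq g
  refine le_depth_of_mem_pow (k := 2) ?_
  rw [ha, Submodule.pow_succ, Submodule.pow_one]
  refine sum_mem fun i _ => Ideal.mul_mem_mul ?_ (groupLike_sub_one_mem _)
  let θ : F →* (DualNumber (ZMod p))ˣ := (dualNumberHom p).toHomUnits.comp (h i)
  have hθ : IsOpen (θ.ker : Set F) := by
    refine Subgroup.isOpen_mono (fun y (hy : h i y = 1) => ?_) (hopen i)
    change θ y = 1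
    simp [θ, hy]
  have hθval (y : F) : ((θ y : (DualNumber (ZMod p))ˣ) : DualNumber (ZMod p)) =
    1 + TrivSqZeroExt.inr (h i y).toAdd := rfl
  have h1 := completedLift_sub_mem θ hθ
    (I := RingHom.ker (TrivSqZeroExt.fstHom (ZMod p) (ZMod p) (ZMod p))) (fun y => by
      rw [hθval, add_sub_cancel_left, RingHom.mem_ker]
      simp) (a i)
  rw [RingHom.mem_ker, map_sub, AlgHom.commutes] at h1
  have h2 := congrArg (fun z => TrivSqZeroExt.snd (completedLift θ hθ z)) ha
  simp only [map_sub, map_one, map_sum, map_mul, completedLift_groupLike, hθval, hδ, hg,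
    add_sub_cancel_left] at h2
  change augmentation p F (a i) = 0
  simp at h1 h2
  rwa [← h2, zero_sub, neg_eq_zero] at h1

end Generation

/-! ### Minimality forces relators of depth at least 2. -/

section Coordinates

variable {p : ℕ} [Fact p.Prime] {F : Type u} [Group F] [TopologicalSpace F] [IsTopologicalGroup F]

/-- The images of the basis span V, hence W; being d = dim W in number, they form a basis of W,
whose coordinate functions are the h i. The hypothesis `hw` stands in for a topology on V. -/
theorem IsFreeProP.exists_coordinates_of_module {d : ℕ} {x : Fin d → F} (hx : IsFreeProP p x)
    {V W : Type*} [AddCommGroup V] [Module (ZMod p) V] [AddCommGroup W] [Module (ZMod p) W]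
    {w : F →* Multiplicative V} (hw : ∀ S : Set (Multiplicative V), S.Finite → IsClosed (w ⁻¹' S))
    (hsurj : Function.Surjective w) {L₀ : V →+ W} (hL : Function.Surjective L₀)
    (hd : d = Module.finrank (ZMod p) W) :
    ∃ h : Fin d → F →* Multiplicative (ZMod p), (∀ i, IsOpen ((h i).ker : Set F)) ∧
      (∀ i j, h i (x j) = Multiplicative.ofAdd (if i = j then 1 else 0)) ∧
      ∀ g ∈ w.ker, ∀ i, h i g = 1 := by
  let L : V →ₗ[ZMod p] W := L₀.toZModLinearMap p
  have hL' : Function.Surjective L := hL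
  let S : Submodule (ZMod p) V := Submodule.span (ZMod p) (Set.range fun i => (w (x i)).toAdd)
  have _ : Module.Finite (ZMod p) S := FiniteDimensional.span_of_finite _ (Set.finite_range _)
  have hSfin : Finite S := Module.finite_of_finite (ZMod p)
  let C : Subgroup F := (AddSubgroup.toSubgroup S.toAddSubgroup).comap w
  -- S is finite, so its preimage is closed; containing the basis of F, it is everything, whence V =
  -- S is finite.
  have hCclosed : IsClosed (C : Set F) := hw _ (Set.toFinite (S : Set V))
  have hCtop : C = ⊤ := hx.eq_top_of_isClosed hCclosed fun i => Submodule.subset_span ⟨i, rfl⟩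
  have hStop : S = ⊤ := by
    refine eq_top_iff.2 fun y _ => ?_
    obtain ⟨g, hg⟩ := hsurj (Multiplicative.ofAdd y)
    have h1 : g ∈ C := hCtop ▸ Subgroup.mem_top g
    have h2 : (w g).toAdd ∈ S := h1
    rwa [hg] at h2
  have hVfin : Finite V := by
    rw [hStop] at hSfin
    exact Finite.of_equiv _ (Submodule.topEquiv (R := ZMod p) (M := V)).toEquiv
  have hspan : ⊤ ≤ Submodule.span (ZMod p) (Set.range (L ∘ fun i => (w (x i)).toAdd)) := by
    rw [Set.range_comp, ← Submodule.map_span]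
    change ⊤ ≤ Submodule.map L S
    rw [hStop, Submodule.map_top, LinearMap.range_eq_top.2 hL']
  let b := basisOfTopLeSpanOfCardEqFinrank _ hspan ((Fintype.card_fin _).trans hd)
  have hb (i) : b i = L (w (x i)).toAdd :=
    congrFun (coe_basisOfTopLeSpanOfCardEqFinrank _ _ _) i
  refine ⟨fun i => (AddMonoidHom.toMultiplicative ((b.coord i).comp L).toAddMonoidHom).comp w,
    fun i => ?_, fun i j => ?_, fun g hg i => ?_⟩
  · refine Subgroup.isOpen_mono (H₁ := w.ker) (fun g hg => ?_) ?_
    · rw [MonoidHom.mem_ker] at hg ⊢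
      rw [MonoidHom.comp_apply, hg, map_one]
    · rw [← isClosed_compl_iff]
      exact hw {1}ᶜ (@Set.toFinite _ _ (@Subtype.finite (Multiplicative V) hVfin _))
  · change Multiplicative.ofAdd (b.coord i (L (w (x j)).toAdd)) = _
    rw [← hb, Module.Basis.coord_apply, Module.Basis.repr_self, Finsupp.single_apply]
    simp only [eq_comm]
  · rw [MonoidHom.comp_apply, MonoidHom.mem_ker.1 hg, map_one]

/-- Applied to V = A / A^p, Hausdorff because A^p is compact, and W = 𝔽_p ⊗ A, onto which V maps by
a ↦ 1 ⊗ a. -/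
theorem IsFreeProP.exists_coordinates {d : ℕ} {x : Fin d → F} (hx : IsFreeProP p x) {A : Type v}
    [CommGroup A] [TopologicalSpace A] [IsTopologicalGroup A] [CompactSpace A] [T2Space A]
    {π : F →* A} (hπ : Continuous π) (hsurj : Function.Surjective π)
    (hd : d = Module.finrank (ZMod p) (ZMod p ⊗[ℤ] Additive A)) :
    ∃ h : Fin d → F →* Multiplicative (ZMod p), (∀ i, IsOpen ((h i).ker : Set F)) ∧
      (∀ i j, h i (x j) = Multiplicative.ofAdd (if i = j then 1 else 0)) ∧
      ∀ g ∈ π.ker, ∀ i, h i g = 1 := by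
  let B : Subgroup A := (powMonoidHom p : A →* A).range
  have _ : IsClosed (B : Set A) := (isCompact_range (continuous_pow p)).isClosed
  let _ : Module (ZMod p) (Additive (A ⧸ B)) := AddCommGroup.zmodModule fun y => by
    obtain ⟨a, ha⟩ := QuotientGroup.mk_surjective y.toMul
    change y.toMul ^ p = 1
    rw [← ha, ← QuotientGroup.mk_pow]
    exact (QuotientGroup.eq_one_iff _).2 ⟨a, rfl⟩
  let w : F →* Multiplicative (Additive (A ⧸ B)) := (QuotientGroup.mk' B).comp π
  have hw : ∀ S : Set (Multiplicative (Additive (A ⧸ B))), S.Finite → IsClosed (w ⁻¹' S) :=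
    fun S hS => IsClosed.preimage (Y := A ⧸ B) (f := w) (QuotientGroup.continuous_mk.comp hπ)
      (Set.Finite.isClosed (X := A ⧸ B) hS)
  have hwsurj : Function.Surjective w := (QuotientGroup.mk'_surjective B).comp hsurj
  let L₀ : A →* Multiplicative (ZMod p ⊗[ℤ] Additive A) :=
    { toFun := fun a => Multiplicative.ofAdd ((1 : ZMod p) ⊗ₜ[ℤ] Additive.ofMul a)
      map_one' := TensorProduct.tmul_zero _ _
      map_mul' := fun a b => TensorProduct.tmul_add _ _ _ }
  have hL₀ : B ≤ L₀.ker := by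
    rintro _ ⟨b, rfl⟩
    rw [MonoidHom.mem_ker]
    change L₀ (b ^ p) = 1
    rw [map_pow]
    change p • ((1 : ZMod p) ⊗ₜ[ℤ] Additive.ofMul b) = 0
    rw [TensorProduct.smul_tmul', nsmul_one, CharP.cast_eq_zero, TensorProduct.zero_tmul]
  let L : Additive (A ⧸ B) →+ ZMod p ⊗[ℤ] Additive A :=
    { toFun := fun y => (QuotientGroup.lift B L₀ hL₀ y.toMul).toAdd
      map_zero' := by rw [toMul_zero, map_one, toAdd_one]
      map_add' := fun y z => by rw [toMul_add, map_mul, toAdd_mul] }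
  have hL : Function.Surjective L := by
    intro y
    induction y using TensorProduct.induction_on with
    | zero => exact ⟨0, map_zero _⟩
    | add y z hy hz =>
      obtain ⟨a, rfl⟩ := hy
      obtain ⟨b, rfl⟩ := hz
      exact ⟨a + b, map_add _ _ _⟩
    | tmul c a =>
      obtain ⟨n, rfl⟩ := ZMod.natCast_zmod_surjective c
      refine ⟨n • Additive.ofMul (QuotientGroup.mk a.toMul), ?_⟩
      rw [map_nsmul]
      change n • ((1 : ZMod p) ⊗ₜ[ℤ] a) = _
      rw [TensorProduct.smul_tmul', nsmul_one]
  obtain ⟨h, h1, h2, h3⟩ := hx.exists_coordinates_of_module hw hwsurj hL hd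
  refine ⟨h, h1, h2, fun g hg => h3 g ?_⟩
  change QuotientGroup.mk' B (π g) = 1
  rw [MonoidHom.mem_ker.1 hg, map_one]

variable {G : Type v} [Group G] [TopologicalSpace G] [IsTopologicalGroup G]

theorem MinimalPresentation.two_le_depth (P : MinimalPresentation p F G) (hG : IsProP p G) {g : F}
    (hg : g ∈ P.R) : (2 : ℕ∞) ≤ depth p g := by
  have := hG.compact
  have _ : IsClosed ((commutator G).topologicalClosure : Set G) :=
    Subgroup.isClosed_topologicalClosure _
  have _ : CompactSpace (TopologicalAbelianization G) := Quotient.compactSpace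
  have _ : T3Space (TopologicalAbelianization G) := QuotientGroup.instT3Space _
  let π : F →* TopologicalAbelianization G :=
    (QuotientGroup.mk' (commutator G).topologicalClosure).comp P.φ.toMonoidHom
  have hπ : Continuous π := QuotientGroup.continuous_mk.comp P.φ.continuous_toFun
  have hsurj : Function.Surjective π := (QuotientGroup.mk'_surjective _).comp P.surjective
  obtain ⟨h, hopen, hδ, hR⟩ := P.free.exists_coordinates hπ hsurj P.minimal
  refine P.free.two_le_depth h hopen hδ (hR g ?_)
  change QuotientGroup.mk' (commutator G).topologicalClosure (P.φ.toMonoidHom g) = 1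
  rw [MonoidHom.mem_ker.1 hg, map_one]

end Coordinates

/-! ### Counting relators and comparing the two quotients. -/

namespace MinimalPresentation

variable {p : ℕ} [Fact p.Prime] {F : Type u} {G : Type v}
  [Group F] [TopologicalSpace F] [IsTopologicalGroup F]
  [Group G] [TopologicalSpace G] [IsTopologicalGroup G] (P : MinimalPresentation p F G)

/-- The relators of finite depth. -/
abbrev FiniteDepthRelator : Type u := {ρ : F // ρ ∈ P.relators ∧ depth p ρ ≠ ⊤}

variable {P}

/-- The depth of a relator of finite depth. -/
def FiniteDepthRelator.level (ρ : P.FiniteDepthRelator) : ℕ := (depth p ρ.1).toNat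

theorem FiniteDepthRelator.coe_level (ρ : P.FiniteDepthRelator) : (ρ.level : ℕ∞) = depth p ρ.1 :=
  ENat.natCast_toNat ρ.2.2

theorem relators_subset_R (P : MinimalPresentation p F G) : P.relators ⊆ P.R := by
  rw [R, P.ker_eq]
  exact subset_closedNormalClosure _

theorem FiniteDepthRelator.two_le_level (hG : IsProP p G) (ρ : P.FiniteDepthRelator) :
    2 ≤ ρ.level := by
  have := P.two_le_depth hG (P.relators_subset_R ρ.2.1)
  rw [← ρ.coe_level] at this
  exact_mod_cast this

theorem finite_level_eq (P : MinimalPresentation p F G) (k : ℕ) :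
    {ρ : P.FiniteDepthRelator | ρ.level = k}.Finite := by
  refine Set.Finite.of_finite_image (f := Subtype.val) ((P.finite_depth k).subset ?_)
    Subtype.val_injective.injOn
  rintro _ ⟨ρ, hρ, rfl⟩
  exact ⟨ρ.2.1, by rw [← FiniteDepthRelator.coe_level ρ, show FiniteDepthRelator.level ρ =
      k from hρ]⟩

theorem ncard_level_eq_le (P : MinimalPresentation p F G) (k : ℕ) :
    {ρ : P.FiniteDepthRelator | ρ.level = k}.ncard ≤ P.r k := by
  rw [← Set.ncard_image_of_injective _ (Subtype.val_injective (p := fun ρ : F =>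
    ρ ∈ P.relators ∧ depth p ρ ≠ ⊤))]
  refine Set.ncard_le_ncard ?_ (P.finite_depth k)
  rintro _ ⟨ρ, hρ, rfl⟩
  exact ⟨ρ.2.1, by rw [← FiniteDepthRelator.coe_level ρ, show FiniteDepthRelator.level ρ =
      k from hρ]⟩

theorem finite_level_lt (P : MinimalPresentation p F G) (n : ℕ) :
    {ρ : P.FiniteDepthRelator | ρ.level < n}.Finite := by
  have : {ρ : P.FiniteDepthRelator | ρ.level < n} =
      ⋃ k ∈ Finset.range n, {ρ : P.FiniteDepthRelator | ρ.level = k} := by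
    ext ρ
    simp
  rw [this]
  exact (Finset.range n).finite_toSet.biUnion fun k _ => P.finite_level_eq k

/-- Grouping by level bounds the sum by a partial sum of the series: levels 0 and 1 are empty, and
the omitted coefficients are nonnegative. -/
theorem sum_pow_level_le_value (hG : IsProP p G) {t : ℝ} (ht : 0 ≤ t) (hconv : P.ConvergesAt t)
    (s : Finset P.FiniteDepthRelator) : 1 - P.d * t + ∑ ρ ∈ s, t ^ ρ.level ≤ P.value t := by
  classical
  set n := s.sup FiniteDepthRelator.level + 1 with hn
  have hmaps : ∀ ρ ∈ s, ρ.level ∈ Finset.range (n + 2) := fun ρ hρ => by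
    have := Finset.le_sup (f := FiniteDepthRelator.level) hρ
    rw [Finset.mem_range]
    omega
  have hfib (k : ℕ) : ∑ ρ ∈ s with ρ.level = k, t ^ ρ.level ≤
      if k < 2 then 0 else P.r k * t ^ k := by
    split_ifs with hk
    · refine (Finset.sum_eq_zero fun ρ hρ => ?_).le
      have h1 := ρ.two_le_level hG
      have h2 := (Finset.mem_filter.1 hρ).2
      omega
    · rw [Finset.sum_congr rfl fun ρ hρ => by rw [(Finset.mem_filter.1 hρ).2], Finset.sum_const,
        nsmul_eq_mul]
      refine mul_le_mul_of_nonneg_right ?_ (pow_nonneg ht k)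
      refine Nat.cast_le.2 (le_trans ?_ (P.ncard_level_eq_le k))
      rw [← Set.ncard_coe_finset]
      exact Set.ncard_le_ncard (fun ρ hρ => (Finset.mem_filter.1 hρ).2) (P.finite_level_eq k)
  have h1 : ∑ ρ ∈ s, t ^ ρ.level ≤
      ∑ k ∈ Finset.range (n + 2), if k < 2 then 0 else P.r k * t ^ k := by
    rw [← Finset.sum_fiberwise_of_maps_to hmaps]
    exact Finset.sum_le_sum fun k _ => hfib k
  have h2 : 1 - P.d * t + ∑ k ∈ Finset.range (n + 2), (if k < 2 then 0 else P.r k * t ^ k) =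
      ∑ k ∈ Finset.range (n + 2), PowerSeries.coeff k P.series * t ^ k := by
    simp only [Finset.sum_range_succ' _ (n + 1), Finset.sum_range_succ' _ n, series,
      PowerSeries.coeff_mk]
    simp
    ring
  have h3 : ∑ k ∈ Finset.range (n + 2), PowerSeries.coeff k P.series * t ^ k ≤ P.value t := by
    refine hconv.sum_le_tsum _ fun k hk => mul_nonneg ?_ (pow_nonneg ht k)
    rw [Finset.mem_range, not_lt] at hk
    rw [series, PowerSeries.coeff_mk, if_neg (by omega), if_neg (by omega)]
    exact Nat.cast_nonneg _
  linarith

theorem addRelations_eq (P : MinimalPresentation p F G) (T : Set F) :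
    P.addRelations T = closedNormalClosure (P.relators ∪ T) := by
  refine le_antisymm ?_ ?_
  · refine closedNormalClosure_le (Subgroup.isClosed_topologicalClosure _) (Set.union_subset ?_ ?_)
    · rw [R, P.ker_eq]
      exact closedNormalClosure_le (Subgroup.isClosed_topologicalClosure _)
        (Set.subset_union_left.trans (subset_closedNormalClosure _))
    · exact Set.subset_union_right.trans (subset_closedNormalClosure _)
  · exact closedNormalClosure_le (Subgroup.isClosed_topologicalClosure _)
      ((Set.union_subset_union_left _ P.relators_subset_R).trans (subset_closedNormalClosure _))

/-- Adding relators of depths at least `ℓ i` leaves an infinite group if the Golod-Shafarevich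
series stays non-positive at some `t`. -/
theorem infinite_quotient_addRelations (hG : IsProP p G) {t : ℝ} (ht : t ∈ Set.Ioo (0 : ℝ) 1)
    (hconv : P.ConvergesAt t) {κ : Type*} (f : κ → F) (ℓ : κ → ℕ) (hℓ : ∀ i, 1 ≤ ℓ i)
    (hf : ∀ i, (ℓ i : ℕ∞) ≤ depth p (f i)) (hfin : ∀ n, {i | ℓ i < n}.Finite)
    (hneg : ∀ s : Finset κ, P.value t + ∑ i ∈ s, t ^ ℓ i ≤ 0) :
    Infinite (F ⧸ P.addRelations (Set.range f)) := by
  rw [P.addRelations_eq]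
  refine P.free.infinite_quotient (ι := P.FiniteDepthRelator ⊕ κ)
    (Sum.elim (fun ρ => ρ.1) f) (Sum.elim FiniteDepthRelator.level ℓ) ?_ ?_ (fun n => ?_) ht
    (fun s => ?_) fun g hg => ?_
  · rintro (ρ | i)
    · exact one_le_two.trans (ρ.two_le_level hG)
    · exact hℓ i
  · rintro (ρ | i)
    · exact ρ.coe_level.le
    · exact hf i
  · refine (((P.finite_level_lt n).image Sum.inl).union ((hfin n).image Sum.inr)).subset ?_
    rintro (ρ | i) h
    · exact Or.inl ⟨ρ, h, rfl⟩
    · exact Or.inr ⟨i, h, rfl⟩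
  · rw [← s.toLeft_disjSum_toRight, Finset.sum_disjSum]
    have h1 := sum_pow_level_le_value hG ht.1.le hconv s.toLeft
    have h2 := hneg s.toRight
    simp only [Sum.elim_inl, Sum.elim_inr]
    linarith
  · rcases hg with hg | ⟨i, rfl⟩
    · by_cases h : depth p g = ⊤
      · exact Or.inr h
      · exact Or.inl ⟨Sum.inl ⟨g, hg, h⟩, rfl⟩
    · exact Or.inl ⟨Sum.inr i, rfl⟩

theorem comap_cut (P : MinimalPresentation p F G) (T : Set F) :
    (P.cut T).comap P.φ.toMonoidHom = P.addRelations T := by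
  have := P.free.isProP.compact
  have := P.free.isProP.hausdorff
  rw [cut, Subgroup.comap_map_eq]
  refine le_antisymm (sup_le ?_ ?_) ?_
  · exact closedNormalClosure_le (Subgroup.isClosed_topologicalClosure _)
      (Set.subset_union_right.trans (subset_closedNormalClosure _))
  · exact Set.subset_union_left.trans (subset_closedNormalClosure _)
  · have hR : IsClosed (P.R : Set F) := by
      rw [R, P.ker_eq]
      exact Subgroup.isClosed_topologicalClosure _
    have hT : IsClosed (closedNormalClosure T : Set F) := Subgroup.isClosed_topologicalClosure _
    refine closedNormalClosure_le ?_ (Set.union_subset ?_ ?_)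
    -- The join is a product of two compact sets, hence closed.
    · rw [Subgroup.mul_normal (closedNormalClosure T) P.R]
      exact (hT.isCompact.mul hR.isCompact).isClosed
    · exact fun g hg => Subgroup.mem_sup_right hg
    · exact fun g hg => Subgroup.mem_sup_left (subset_closedNormalClosure T hg)

theorem exists_continuousMulEquiv (P : MinimalPresentation p F G) (hG : IsProP p G) (T : Set F) :
    ∃ e : (F ⧸ P.addRelations T) ≃ₜ* (G ⧸ P.cut T),
      ∀ y : F, e (QuotientGroup.mk y) = QuotientGroup.mk (P.φ y) := by
  have := P.free.isProP.compact
  have := hG.hausdorff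
  have _ : IsClosed (P.cut T : Set G) :=
    ((Subgroup.isClosed_topologicalClosure _).isCompact.image P.φ.continuous_toFun).isClosed
  let ψ : F →* G ⧸ P.cut T := (QuotientGroup.mk' (P.cut T)).comp P.φ.toMonoidHom
  have hker : P.addRelations T = ψ.ker := by
    rw [← P.comap_cut]
    ext g
    exact (QuotientGroup.eq_one_iff (N := P.cut T) (P.φ g)).symm
  let q : (F ⧸ P.addRelations T) →* G ⧸ P.cut T := QuotientGroup.lift _ ψ hker.le
  have hcont : Continuous q :=
    Continuous.quotient_lift (QuotientGroup.continuous_mk.comp P.φ.continuous_toFun) _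
  have hbij : Function.Bijective q := by
    constructor
    · rw [injective_iff_map_eq_one]
      intro y hy
      obtain ⟨g, rfl⟩ := QuotientGroup.mk_surjective y
      exact (QuotientGroup.eq_one_iff _).2 (hker ▸ hy)
    · intro y
      obtain ⟨g, rfl⟩ := QuotientGroup.mk_surjective y
      obtain ⟨h, rfl⟩ := P.surjective g
      exact ⟨QuotientGroup.mk h, rfl⟩
  let e := MulEquiv.ofBijective q hbij
  have he : Continuous e := hcont
  exact ⟨{ e with
    continuous_toFun := he
    continuous_invFun := he.continuous_symm_of_equiv_compact_to_t2 (f := e.toEquiv) }, fun y => rfl⟩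

end MinimalPresentation

end GolodShafarevich

end

/-! ### The main theorem. -/

theorem mainTheorem6 {p : ℕ} [Fact p.Prime] {F : Type*} {G : Type*}
    [Group F] [TopologicalSpace F] [IsTopologicalGroup F]
    [Group G] [TopologicalSpace G] [IsTopologicalGroup G]
    (hG : GolodShafarevich.IsProP p G)
    (P : GolodShafarevich.MinimalPresentation p F G)
    (t₀ : ℝ) (ht₀ : t₀ ∈ Set.Ioo (0 : ℝ) 1)
    (hconv : P.ConvergesAt t₀) (hneg : P.value t₀ < 0) :
    (∀ᶠ k : ℕ in Filter.atTop, 2 ≤ k ∧ P.value t₀ + t₀ ^ k < 0) ∧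
    (∀ᶠ k' : ℕ in Filter.atTop, 2 ≤ k' ∧ P.value t₀ + t₀ ^ k' / (1 - t₀) < 0) ∧
    (∀ k : ℕ, 2 ≤ k → P.value t₀ + t₀ ^ k < 0 →
      ∀ f : F, (k : ℕ∞) ≤ GolodShafarevich.depth p f →
        (∃ e : (F ⧸ P.addRelations {f}) ≃ₜ* (G ⧸ P.cut {f}),
          ∀ y : F, e (QuotientGroup.mk y) = QuotientGroup.mk (P.φ y)) ∧
        Infinite (F ⧸ P.addRelations {f}) ∧ Infinite (G ⧸ P.cut {f})) ∧
    (∀ k' : ℕ, 2 ≤ k' → P.value t₀ + t₀ ^ k' / (1 - t₀) < 0 →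
      ∀ f : ℕ → F, (∀ i : ℕ, ((k' + i : ℕ) : ℕ∞) ≤ GolodShafarevich.depth p (f i)) →
        (∃ e : (F ⧸ P.addRelations (Set.range f)) ≃ₜ* (G ⧸ P.cut (Set.range f)),
          ∀ y : F, e (QuotientGroup.mk y) = QuotientGroup.mk (P.φ y)) ∧
        Infinite (F ⧸ P.addRelations (Set.range f)) ∧ Infinite (G ⧸ P.cut (Set.range f))) := by
  have hpow := tendsto_pow_atTop_nhds_zero_of_lt_one ht₀.1.le ht₀.2
  have transfer (T : Set F) (h : Infinite (F ⧸ P.addRelations T)) :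
      (∃ e : (F ⧸ P.addRelations T) ≃ₜ* (G ⧸ P.cut T),
        ∀ y : F, e (QuotientGroup.mk y) = QuotientGroup.mk (P.φ y)) ∧
      Infinite (F ⧸ P.addRelations T) ∧ Infinite (G ⧸ P.cut T) := by
    obtain ⟨e, he⟩ := P.exists_continuousMulEquiv hG T
    exact ⟨⟨e, he⟩, h, Infinite.of_injective e e.injective⟩
  refine ⟨?_, ?_, fun k hk hlt f hf => transfer _ ?_, fun k hk hlt f hf => transfer _ ?_⟩
  · have h := hpow.const_add (P.value t₀)
    rw [add_zero] at h
    exact (Filter.eventually_ge_atTop 2).and (h.eventually (gt_mem_nhds hneg))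
  · have h := (hpow.div_const (1 - t₀)).const_add (P.value t₀)
    rw [zero_div, add_zero] at h
    exact (Filter.eventually_ge_atTop 2).and (h.eventually (gt_mem_nhds hneg))
  · rw [← Set.range_const (ι := Unit) (c := f)]
    refine P.infinite_quotient_addRelations hG ht₀ hconv (fun _ : Unit => f) (fun _ => k)
      (fun _ => one_le_two.trans hk) (fun _ => hf) (fun _ => Set.toFinite _) fun s => ?_
    have h : ∑ _i ∈ s, t₀ ^ k ≤ ∑ _i : Unit, t₀ ^ k :=
      Finset.sum_le_sum_of_subset_of_nonneg (Finset.subset_univ s)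
        fun _ _ _ => pow_nonneg ht₀.1.le k
    rw [Finset.univ_unique, Finset.sum_singleton] at h
    linarith
  · refine P.infinite_quotient_addRelations hG ht₀ hconv f (fun i => k + i)
      (fun i => one_le_two.trans (hk.trans (Nat.le_add_right k i))) hf
      (fun n => (Set.finite_lt_nat n).subset fun i hi => ?_) fun s => ?_
    · exact lt_of_le_of_lt (Nat.le_add_left i k) hi
    -- Every finite sum of t₀ ^ (k + i) is at most the full geometric sum t₀ ^ k / (1 - t₀).
    · have hs := (hasSum_geometric_of_lt_one ht₀.1.le ht₀.2).mul_left (t₀ ^ k)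
      have h := sum_le_hasSum s (fun i _ => mul_nonneg (pow_nonneg ht₀.1.le k)
        (pow_nonneg ht₀.1.le i)) hs
      simp only [← pow_add, ← div_eq_mul_inv] at h
      linarith
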